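/- **Proposition 3.6.** Let $p\in\{3,5\}$ and let $\gamma$ be a topological generator of $1+p\mathbf Z_p$. For $k\in\mathbf Z$ put $w_k=\gamma^k-1\in\mathbf Z_p$, let $d_k=\dim S_k(\mathrm{SL}_2(\mathbf Z))$, and let $d_k^{\mathrm{new}}=\dim S_k(\Gamma_0(p))^{p\text{-new}}$ be the dimension of the orthogonal complement, for the Petersson product, of the span of the forms $f(z)$ and $f(pz)$ with $f\in S_k(\mathrm{SL}_2(\mathbf Z))$. For an integer $\ell\ge 1$ let $s_j(\ell)=j$ if $1\le j\le\lfloor \ell/2\rfloor$, let $s_j(\ell)=\ell+1-j$ if $\lfloor \ell/2\rfloor<j\le\ell$, and let $s_j(\ell)=0$ for all other integers $j$; for $\ell\le 0$ let $s_j(\ell)=0$ for all $j$. For $i\ge 1$ put $m_i(k)=s_{i-d_k}(d_k^{\mathrm{new}}-1)$. Consider the $p$-adic ghost series of tame level $N=1$ on the component of the even $p$-adic weight space containing the weight $0$ (the trivial character of $\mathbf Z_p^\times$), $$G(w,t)=1+\sum_{i\ge 1}g_i(w)t^i,\qquad g_i(w)=\prod_{k\equiv 0 \bmod (p-1)}(w-w_k)^{m_i(k)}\in\mathbf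 Z_p[w],$$ where the product runs over the integers $k$ whose weight $z\mapsto z^k$ lies on that component, i.e. $k\equiv 0\bmod (p-1)$, and only finitely many factors differ from $1$. Let $G_0(t)=G(0,t)$ be its specialization at the weight $0$ (whose coordinate is $w_0=0$), and let $\mathrm{NP}(G_0)$ be its Newton polygon, that is, the lower convex hull of the points $(i,v_p(g_i(0)))$ with $i\ge 0$ and $g_i(0)\ne 0$, where $g_0=1$ and $v_p(p)=1$. Then, for every $i\ge 1$, the $i$-th slope of $\mathrm{NP}(G_0)$ (slopes listed in increasing order and with multiplicity, i.e. the slope of $\mathrm{NP}(G_0)$ over $[i-1,i]$) is $$\begin{cases}2i+2\,v_3\!\left(\dfrac{(2i)!}{i!}\right)&\text{if }p=3,\\[2ex] i+2\,v_5\!\left(\dfrac{(3i)!}{i!}\right)&\text{if }p=5.\end{cases}$$ -/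

import Mathlib

open scoped MatrixGroups Modular

noncomputable section

namespace Ghost

/-! ### Cusp forms of level `Γ₀(M)`, the `p`-old and the `p`-new part -/

/-- `Γ₀(M)` as a subgroup of `GL₂(ℝ)`. -/
abbrev levelGamma0 (M : ℕ) : Subgroup (GL (Fin 2) ℝ) :=
  (CongruenceSubgroup.Gamma0 M).map (Matrix.SpecialLinearGroup.mapGL ℝ)

/-- The space `S_k(Γ₀(M))` of holomorphic cusp forms of weight `k` and level `Γ₀(M)`. -/
abbrev CuspSpace (M : ℕ) (k : ℤ) : Type :=
  CuspForm (levelGamma0 M) k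

/-- The point `m τ` of the upper half plane, for an integer `m ≥ 1`. -/
def scale (m : ℕ) [NeZero m] (τ : UpperHalfPlane) : UpperHalfPlane :=
  ⟨(m : ℂ) * τ, by
    have h : (0 : ℝ) < m := by exact_mod_cast Nat.pos_of_ne_zero (NeZero.ne m)
    simpa using mul_pos h τ.im_pos⟩

/-- The `p`-old subspace of `S_k(Γ₀(Np))`: the span of the forms `f(τ)` and `f(pτ)`,
with `f` in `S_k(Γ₀(N))`. -/
def pOld (N p : ℕ) [NeZero p] (k : ℤ) : Submodule ℂ (CuspSpace (N * p) k) :=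
  Submodule.span ℂ {h | ∃ f : CuspSpace N k,
    (∀ τ, h τ = f τ) ∨ (∀ τ, h τ = f (scale p τ))}

/-- The Petersson product on `S_k(Γ₀(M))`: the integral, against `dx dy / y ^ 2`, of
`conj (f τ) * g τ * (im τ) ^ k` over the fundamental domain of `Γ₀(M)` that is the union of the
translates `γ⁻¹ 𝒟` of the standard fundamental domain `𝒟` of `SL₂(ℤ)`, with `γ` running over
representatives of `SL₂(ℤ) / Γ₀(M)`. -/
def peterssonProduct (M : ℕ) (k : ℤ) (f g : CuspSpace M k) : ℂ :=
  ∑ᶠ γ : SL(2, ℤ) ⧸ CongruenceSubgroup.Gamma0 M,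
    ∫ τ in 𝒟, UpperHalfPlane.petersson k f g (γ.out⁻¹ • τ)

theorem volume_fd_lt_top : MeasureTheory.volume (𝒟 : Set UpperHalfPlane) < ⊤ := by
  rw [UpperHalfPlane.volume_eq_lintegral]
  have hsub : UpperHalfPlane.coe '' (𝒟 : Set UpperHalfPlane) ⊆
      Complex.measurableEquivRealProd ⁻¹' (Set.Icc (-1 : ℝ) 1 ×ˢ Set.Ioi (1 / 2 : ℝ)) := by
    rintro _ ⟨τ, ⟨h1, h2⟩, rfl⟩
    have h3 := τ.im_pos
    rw [Complex.normSq_apply] at h1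
    have h4 := abs_le.mp h2
    simp only [UpperHalfPlane.coe_re, UpperHalfPlane.coe_im] at h1
    simp only [Set.mem_preimage, Complex.measurableEquivRealProd_apply, Set.mem_prod, Set.mem_Icc,
      Set.mem_Ioi, UpperHalfPlane.coe_re, UpperHalfPlane.coe_im]
    exact ⟨⟨by linarith, by linarith⟩, by nlinarith⟩
  refine (MeasureTheory.lintegral_mono_set hsub).trans_lt ?_
  have hm : Measurable fun y : ℝ => (((1 / ‖y‖₊) ^ 2 : NNReal) : ENNReal) := by fun_prop
  have key := Complex.volume_preserving_equiv_real_prod.setLIntegral_comp_preimage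
    (s := Set.Icc (-1 : ℝ) 1 ×ˢ Set.Ioi (1 / 2 : ℝ))
    (f := fun q : ℝ × ℝ => (((1 / ‖q.2‖₊) ^ 2 : NNReal) : ENNReal))
    (measurableSet_Icc.prod measurableSet_Ioi) (hm.comp measurable_snd)
  simp only [Complex.measurableEquivRealProd_apply] at key
  rw [key, MeasureTheory.Measure.volume_eq_prod, ← MeasureTheory.Measure.prod_restrict,
    MeasureTheory.lintegral_prod (fun q : ℝ × ℝ => (((1 / ‖q.2‖₊) ^ 2 : NNReal) : ENNReal))
      (hm.comp measurable_snd).aemeasurable]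
  simp only [MeasureTheory.lintegral_const, MeasureTheory.Measure.restrict_apply,
    MeasurableSet.univ, Set.univ_inter, Real.volume_Icc]
  refine ENNReal.mul_lt_top ?_ ENNReal.ofReal_lt_top
  have hi : MeasureTheory.IntegrableOn (fun y : ℝ => y ^ (-2 : ℝ)) (Set.Ioi (1 / 2 : ℝ)) :=
    integrableOn_Ioi_rpow_of_lt (by norm_num) (by norm_num)
  refine lt_of_eq_of_lt ?_ hi.hasFiniteIntegral
  refine MeasureTheory.setLIntegral_congr_fun measurableSet_Ioi fun y hy => ?_
  have hy0 : (0 : ℝ) < y := lt_trans (by norm_num) hy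
  rw [enorm_eq_nnnorm, ENNReal.coe_inj]
  ext
  simp [Real.rpow_neg hy0.le]

theorem integrableOn_petersson (M : ℕ) [NeZero M] (k : ℤ) (f g : CuspSpace M k) (γ : SL(2, ℤ)) :
    MeasureTheory.IntegrableOn (fun τ => UpperHalfPlane.petersson k f g (γ • τ)) 𝒟 := by
  obtain ⟨C, hC⟩ := CuspFormClass.petersson_bounded_left k (levelGamma0 M) f g
  have hc : Continuous (UpperHalfPlane.petersson k f g) :=
    UpperHalfPlane.petersson_continuous k (CuspFormClass.holo f).continuous
      (CuspFormClass.holo g).continuous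
  have hγ : Continuous fun τ : UpperHalfPlane => γ • τ :=
    continuous_const_smul (Matrix.SpecialLinearGroup.mapGL ℝ γ)
  refine MeasureTheory.Measure.integrableOn_of_bounded (M := C) volume_fd_lt_top.ne
    (hc.comp hγ).aestronglyMeasurable (.of_forall fun τ => hC _)

theorem peterssonProduct_add (M : ℕ) [NeZero M] (k : ℤ) (f₁ f₂ g : CuspSpace M k) :
    peterssonProduct M k (f₁ + f₂) g = peterssonProduct M k f₁ g + peterssonProduct M k f₂ g := by
  rw [peterssonProduct, peterssonProduct, peterssonProduct,
    ← finsum_add_distrib (Set.toFinite _) (Set.toFinite _)]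
  refine finsum_congr fun γ => ?_
  rw [← MeasureTheory.integral_add (integrableOn_petersson M k f₁ g _)
    (integrableOn_petersson M k f₂ g _)]
  refine MeasureTheory.integral_congr_ae (.of_forall fun τ => ?_)
  simp [UpperHalfPlane.petersson, add_mul]

theorem peterssonProduct_smul (M : ℕ) (k : ℤ) (c : ℂ) (f g : CuspSpace M k) :
    peterssonProduct M k (c • f) g = (starRingEnd ℂ) c * peterssonProduct M k f g := by
  rw [peterssonProduct, peterssonProduct, ← smul_eq_mul, smul_finsum]
  refine finsum_congr fun γ => ?_
  rw [smul_eq_mul, ← MeasureTheory.integral_const_mul]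
  refine MeasureTheory.integral_congr_ae (.of_forall fun τ => ?_)
  simp [UpperHalfPlane.petersson, mul_assoc]

/-- The `p`-new subspace of `S_k(Γ₀(Np))`: the orthogonal complement of the `p`-old subspace
for the Petersson product. -/
def pNew (N p : ℕ) [NeZero N] [NeZero p] (k : ℤ) : Submodule ℂ (CuspSpace (N * p) k) where
  carrier := {h | ∀ g ∈ pOld N p k, peterssonProduct (N * p) k h g = 0}
  zero_mem' g _ := by
    have := peterssonProduct_smul (N * p) k 0 0 g
    simpa using this
  add_mem' {a b} ha hb g hg := by
    rw [peterssonProduct_add, ha g hg, hb g hg, add_zero]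
  smul_mem' c a ha g hg := by
    rw [peterssonProduct_smul, ha g hg, mul_zero]

/-- `d_k = dim S_k(Γ₀(N))`. -/
def dimCusp (N : ℕ) (k : ℤ) : ℕ := Module.finrank ℂ (CuspSpace N k)

/-- `d_k^new = dim S_k(Γ₀(Np))^{p-new}`. -/
def dimNew (N p : ℕ) [NeZero N] [NeZero p] (k : ℤ) : ℕ := Module.finrank ℂ (pNew N p k)

/-! ### The multiplicities of the zeros of the ghost coefficients -/

/-- The finite sequence `s₁(ℓ), …, s_ℓ(ℓ)`, that is `1, 2, 3, …, 3, 2, 1`, extended by zero; it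
is empty if `ℓ ≤ 0`. -/
def hill (ℓ i : ℤ) : ℕ :=
  if 1 ≤ i ∧ i ≤ ℓ / 2 then i.toNat
  else if ℓ / 2 < i ∧ i ≤ ℓ ∧ 1 ≤ i then (ℓ + 1 - i).toNat
  else 0

/-- `m_i(k)`, the `i`-th term (`i ≥ 1`) of the sequence `s(d_k^new - 1, d_k)`, which consists of
`d_k` zeros, then `s₁(ℓ), …, s_ℓ(ℓ)` with `ℓ = d_k^new - 1`, then zeros. -/
def mult (N p : ℕ) [NeZero N] [NeZero p] (k : ℤ) (i : ℕ) : ℕ :=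
  hill ((dimNew N p k : ℤ) - 1) ((i : ℤ) - dimCusp N k)

/-! ### Weight space -/

section Weights

variable (p : ℕ) [Fact p.Prime]

/-- The subgroup `1 + 2pℤ_p` of `ℤ_pˣ`. -/
def principalUnits : Subgroup ℤ_[p]ˣ :=
  (Units.map (Ideal.Quotient.mk (Ideal.span {(2 * p : ℤ_[p])})).toMonoidHom).ker

/-- `γ` is a topological generator of `1 + 2pℤ_p`. -/
def IsTopGenerator (γ : ℤ_[p]ˣ) : Prop :=
  (Subgroup.zpowers γ).topologicalClosure = principalUnits p

/-- The inclusion of `ℤ_p` into `ℂ_p`. -/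
def toCp : ℤ_[p] →+* ℂ_[p] :=
  (algebraMap ℚ_[p] ℂ_[p]).comp PadicInt.Coe.ringHom

theorem continuous_toCp : Continuous (toCp p) :=
  (continuous_algebraMap ℚ_[p] ℂ_[p]).comp continuous_subtype_val

/-- The character `z ↦ z ^ k` of `ℤ_pˣ`, with values in `ℂ_pˣ`. -/
def zpowChar (k : ℤ) : ℤ_[p]ˣ →ₜ* ℂ_[p]ˣ where
  toMonoidHom := (zpowGroupHom k).comp (Units.map (toCp p).toMonoidHom)
  continuous_toFun := by
    have h : Continuous (Units.map (toCp p).toMonoidHom) :=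
      Continuous.units_map _ (continuous_toCp p)
    exact (continuous_zpow k).comp h

/-- The even `p`-adic weight space `𝒲`: continuous characters `κ` of `ℤ_pˣ` with values
in `ℂ_pˣ` such that `κ(-1) = 1`. -/
structure EvenWeight where
  char : ℤ_[p]ˣ →ₜ* ℂ_[p]ˣ
  even : char (-1) = 1

/-- An even integer `k`, viewed as the weight `z ↦ z ^ k`. -/
def EvenWeight.ofInt (k : ℤ) (hk : Even k) : EvenWeight p where
  char := zpowChar p k
  even := by
    have h : Units.map (toCp p).toMonoidHom (-1) = -1 := by
      ext
      simp
    change (Units.map (toCp p).toMonoidHom (-1)) ^ k = 1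
    rw [h, hk.neg_one_zpow]

variable {p}

/-- The restriction `ε` of a weight to the torsion subgroup of `ℤ_pˣ`. It determines the
component `𝒲_ε` on which the weight lies. -/
def EvenWeight.tame (κ : EvenWeight p) : CommGroup.torsion ℤ_[p]ˣ →* ℂ_[p]ˣ :=
  κ.char.toMonoidHom.comp (CommGroup.torsion ℤ_[p]ˣ).subtype

/-- The coordinate `w_κ = κ(γ) - 1` of a weight. -/
def EvenWeight.coord (γ : ℤ_[p]ˣ) (κ : EvenWeight p) : ℂ_[p] :=
  (κ.char γ : ℂ_[p]) - 1

/-- The coordinate `w_k = γ ^ k - 1` of an integer weight, as an element of `ℤ_p`. -/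
def intCoord (γ : ℤ_[p]ˣ) (k : ℤ) : ℤ_[p] :=
  ((γ ^ k : ℤ_[p]ˣ) : ℤ_[p]) - 1

/-- The integers `k` that lie on the component `𝒲_ε`. -/
def intWeights (ε : CommGroup.torsion ℤ_[p]ˣ →* ℂ_[p]ˣ) : Set ℤ :=
  {k | ∃ hk : Even k, (EvenWeight.ofInt p k hk).tame = ε}

/-! ### The ghost series -/

/-- The ghost coefficient `g_i^{(ε)}(w) = ∏_{k ∈ 𝒲_ε} (w - w_k) ^ {m_i(k)}`. Only finitely
many factors differ from `1`. -/
def ghostCoeff (N : ℕ) [NeZero N] (γ : ℤ_[p]ˣ) (ε : CommGroup.torsion ℤ_[p]ˣ →* ℂ_[p]ˣ)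
    (i : ℕ) : Polynomial ℤ_[p] :=
  haveI : NeZero p := ⟨(Fact.out : p.Prime).ne_zero⟩
  ∏ᶠ k ∈ intWeights ε, (Polynomial.X - Polynomial.C (intCoord γ k)) ^ mult N p k i

/-- The ghost series `G^{(ε)}(w, t) = 1 + ∑_{i ≥ 1} g_i^{(ε)}(w) t ^ i`. -/
def ghostSeries (N : ℕ) [NeZero N] (γ : ℤ_[p]ˣ) (ε : CommGroup.torsion ℤ_[p]ˣ →* ℂ_[p]ˣ) :
    PowerSeries (Polynomial ℤ_[p]) :=
  PowerSeries.mk fun i => if i = 0 then 1 else ghostCoeff N γ ε i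

/-- The specialization `G_κ(t) = G^{(ε)}(w_κ, t)` of the ghost series of tame level `Γ₀(N)` at a
weight `κ`, with `ε` the character of the component of `κ`. -/
def ghostAt (N : ℕ) [NeZero N] (γ : ℤ_[p]ˣ) (κ : EvenWeight p) : PowerSeries ℂ_[p] :=
  (ghostSeries N γ κ.tame).map (Polynomial.eval₂RingHom (toCp p) (κ.coord γ))

/-! ### Newton polygons -/

/-- The `p`-adic valuation of a nonzero element of `ℂ_p`, normalized by `v_p(p) = 1`. -/
def val (x : ℂ_[p]) : ℝ := -Real.logb p ‖x‖

/-- The points `(i, v_p(a_i))`, with `a_i ≠ 0`, attached to a series `∑ a_i t ^ i`. -/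
def newtonPoints (P : PowerSeries ℂ_[p]) : Set (ℝ × ℝ) :=
  {q | ∃ i : ℕ, P.coeff i ≠ 0 ∧ q = ((i : ℝ), val (P.coeff i))}

/-- The Newton polygon as a function: its value at `x` is the height, over `x`, of the lower
boundary of the convex hull of the points `(i, v_p(a_i))` (with value `⊤` where there is no point
of the hull over `x`, and `⊥` where the hull is not bounded below). -/
def newtonPolygon (P : PowerSeries ℂ_[p]) (x : ℝ) : EReal :=
  ⨅ y ∈ {y : ℝ | (x, y) ∈ convexHull ℝ (newtonPoints P)}, (y : EReal)

/-- The `i`-th slope (`i ≥ 1`) of the Newton polygon, the slopes being listed in increasing order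
and repeated according to the horizontal length of the segments: the slope over `[i - 1, i]`.
It is a real number only if the polygon has finite height at both `i - 1` and `i`. -/
def newtonSlope (P : PowerSeries ℂ_[p]) (i : ℕ) : EReal :=
  newtonPolygon P i - newtonPolygon P ((i : ℝ) - 1)

end Weights

end Ghost

end

noncomputable section
namespace Ghost

/-! ### Valuations of `γ ^ k - 1` and the integer weights on the trivial component -/

section Padic

variable {p : ℕ} [hp : Fact p.Prime]

/-! At weight `0` each factor of a ghost coefficient becomes `-w_k`, and `v_p(w_k) = 1 + v_p(k)` by
lifting the exponent. The factor `k = 0`, which would vanish, has multiplicity zero because there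
are no cusp forms of weight `≤ 0`. Hence `v_p(g_i(0)) = ∑ m_i(k) (1 + v_p(k))`, with `k = 2n` for `p
= 3` and `k = 4n` for `p = 5`, so that `v_p(k) = v_p(n)`.

For fixed `k` the multiplicities climb and then descend by steps of one. For fixed `i`, the change
`m_{i+1}(k) - m_i(k)` is therefore `+1` on an interval of `n` and `-1` on a lower interval, with one
extra isolated `n` when `p = 3` (`hill_three_succ`, `hill_five_succ`). Summing `1 + v_p(n)` over
intervals gives quotients of factorials, and `v_p((pm + r)!) = m + v_p(m!)` collapses them to the
stated slope (`sum_hill_three`, `sum_hill_five`). These increments are nondecreasing in `i`, so the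
points are already in convex position and the slopes are the increments (`newtonSlope_eq`).

The remaining work is to compute `d_k` and `d_k^new`. The Petersson product is definite, so the old
and new dimensions add up to `dim S_k(Γ₀(p))` (`finrank_pOld_add_finrank_pNew`), and the old part
has dimension `2 d_k` (`oldMap_injective`). The norm to level one bounds `dim S_k(Γ₀(p))` from above
(`CuspSpace.eq_zero_of_isBigO`). Multiplication by an explicit cusp form, of weight 6 for `p = 3`
and 4 for `p = 5`, together with Eisenstein series separating the two cusps, gives the matching
lower bound (`finrank_cuspSpace_three`, `finrank_cuspSpace_five`). -/

theorem not_dvd_of_dvd_sub_one {u : ℤ_[p]} (h : (p : ℤ_[p]) ∣ u - 1) : ¬ (p : ℤ_[p]) ∣ u := fun h' =>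
  PadicInt.prime_p.not_dvd_one (by simpa using dvd_sub h' h)

/-- Lifting the exponent: each factor `p` of `n` raises the multiplicity by one (here `p` must be
odd), and the prime-to-`p` part of `n` leaves it unchanged. -/
theorem emultiplicity_pow_sub_one (hodd : Odd p) {u : ℤ_[p]} (h : (p : ℤ_[p]) ∣ u - 1) {n : ℕ}
    (hn : n ≠ 0) :
    emultiplicity (p : ℤ_[p]) (u ^ n - 1) =
      emultiplicity (p : ℤ_[p]) (u - 1) + padicValNat p n := by
  obtain ⟨a, m, hm, rfl⟩ := Nat.exists_eq_pow_mul_and_not_dvd hn p hp.out.ne_one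
  have hm0 : m ≠ 0 := by rintro rfl; simp at hm
  have hv : padicValNat p (p ^ a * m) = a := by
    rw [padicValNat.mul (pow_ne_zero _ hp.out.ne_zero) hm0, padicValNat.prime_pow,
      padicValNat.eq_zero_of_not_dvd hm, add_zero]
  have h1 := emultiplicity_pow_prime_pow_sub_pow_prime_pow (R := ℤ_[p]) PadicInt.prime_p hodd
    (x := u) (y := 1) h (not_dvd_of_dvd_sub_one h) a
  rw [one_pow] at h1
  have hm' : ¬ (p : ℤ_[p]) ∣ (m : ℤ_[p]) := by
    intro hd
    apply hm
    have := (PadicInt.norm_lt_one_iff_dvd (m : ℤ_[p])).mpr hd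
    rw [← Int.cast_natCast, PadicInt.norm_intCast_lt_one_iff] at this
    exact_mod_cast this
  have h2 : (p : ℤ_[p]) ∣ u ^ p ^ a - 1 := h.trans (sub_one_dvd_pow_sub_one u _)
  have h3 := emultiplicity_pow_sub_pow_of_prime (R := ℤ_[p]) PadicInt.prime_p
    (x := u ^ p ^ a) (y := 1) h2 (not_dvd_of_dvd_sub_one h2) hm'
  rw [one_pow] at h3
  rw [hv, pow_mul, h3, h1]

/-- The group `1 + pℤ_p` is torsion-free: otherwise lifting the exponent would equate `⊤` with a
finite multiplicity. -/
theorem eq_one_of_pow_eq_one (hodd : Odd p) {u : ℤ_[p]} (h : (p : ℤ_[p]) ∣ u - 1) {n : ℕ}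
    (hn : n ≠ 0) (hu : u ^ n = 1) : u = 1 := by
  have h1 := emultiplicity_pow_sub_one hodd h hn
  rw [hu, sub_self, emultiplicity_zero] at h1
  by_contra hne
  have hf : FiniteMultiplicity (p : ℤ_[p]) (u - 1) :=
    FiniteMultiplicity.of_prime_left PadicInt.prime_p (sub_ne_zero.mpr hne)
  rw [hf.emultiplicity_eq_multiplicity] at h1
  exact absurd h1.symm (by norm_cast)

theorem mem_principalUnits (hodd : Odd p) (u : ℤ_[p]ˣ) :
    u ∈ principalUnits p ↔ (p : ℤ_[p]) ∣ (u : ℤ_[p]) - 1 := by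
  have h2 : IsUnit (2 : ℤ_[p]) := by
    have : ¬ (p : ℤ_[p]) ∣ ((2 : ℕ) : ℤ_[p]) := by
      rw [← PadicInt.norm_lt_one_iff_dvd, ← Int.cast_natCast, PadicInt.norm_intCast_lt_one_iff]
      intro h
      have := Nat.le_of_dvd two_pos (by exact_mod_cast h : p ∣ 2)
      have h2 := hp.out.two_le
      obtain rfl : p = 2 := by omega
      revert hodd; decide
    rw [PadicInt.isUnit_iff]
    rw [← PadicInt.norm_lt_one_iff_dvd, not_lt] at this
    exact le_antisymm (PadicInt.norm_le_one _) (by simpa using this)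
  rw [principalUnits, MonoidHom.mem_ker, Units.ext_iff]
  simp only [Units.coe_map, Units.val_one, RingHom.toMonoidHom_eq_coe, MonoidHom.coe_coe]
  rw [← map_one (Ideal.Quotient.mk _), Ideal.Quotient.eq, Ideal.mem_span_singleton,
    IsUnit.mul_left_dvd h2]

/-- If `γ ≡ 1` mod `p ^ 2`, the closed subgroup `1 + p²ℤ_p` would contain the closure of the powers
of `γ`, hence also `1 + p`, which is absurd. -/
theorem emultiplicity_topGenerator (hodd : Odd p) {γ : ℤ_[p]ˣ} (hγ : IsTopGenerator p γ) :
    emultiplicity (p : ℤ_[p]) ((γ : ℤ_[p]) - 1) = 1 := by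
  have hmem : γ ∈ principalUnits p := by
    rw [← hγ]
    exact Subgroup.le_topologicalClosure _ (Subgroup.mem_zpowers γ)
  have h1 := (mem_principalUnits hodd γ).mp hmem
  have h2 : ¬ (p : ℤ_[p]) ^ 2 ∣ (γ : ℤ_[p]) - 1 := by
    intro h
    let f : ℤ_[p]ˣ →* (ℤ_[p] ⧸ Ideal.span {(p : ℤ_[p]) ^ 2})ˣ :=
      Units.map (Ideal.Quotient.mk (Ideal.span {(p : ℤ_[p]) ^ 2})).toMonoidHom
    have hf : ∀ u, u ∈ f.ker ↔ (p : ℤ_[p]) ^ 2 ∣ (u : ℤ_[p]) - 1 := by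
      intro u
      rw [MonoidHom.mem_ker, Units.ext_iff]
      simp only [f, Units.coe_map, Units.val_one, RingHom.toMonoidHom_eq_coe, MonoidHom.coe_coe]
      rw [← map_one (Ideal.Quotient.mk _), Ideal.Quotient.eq, Ideal.mem_span_singleton]
    have hclosed : IsClosed (f.ker : Set ℤ_[p]ˣ) := by
      have : (f.ker : Set ℤ_[p]ˣ) =
          (fun u : ℤ_[p]ˣ => ‖(u : ℤ_[p]) - 1‖) ⁻¹' Set.Iic ((p : ℝ) ^ (-(2 : ℕ) : ℤ)) := by
        ext u
        rw [SetLike.mem_coe, hf, Set.mem_preimage, Set.mem_Iic,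
          PadicInt.norm_le_pow_iff_mem_span_pow, Ideal.mem_span_singleton]
      rw [this]
      exact isClosed_Iic.preimage (by fun_prop)
    have hle : principalUnits p ≤ f.ker := by
      rw [← hγ]
      refine Subgroup.topologicalClosure_minimal _ ?_ hclosed
      rw [Subgroup.zpowers_le, hf]
      exact h
    have hu : IsUnit (1 + (p : ℤ_[p])) := by
      rw [PadicInt.isUnit_iff]
      by_contra hne
      have hlt := lt_of_le_of_ne (PadicInt.norm_le_one _) hne
      rw [PadicInt.norm_lt_one_iff_dvd] at hlt
      exact PadicInt.prime_p.not_dvd_one (by simpa using dvd_sub hlt (dvd_refl _))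
    obtain ⟨u, hu⟩ := hu
    have h3 := (hf u).mp (hle ((mem_principalUnits hodd u).mpr (by simp [hu])))
    rw [hu, add_sub_cancel_left] at h3
    have h0 : (p : ℤ_[p]) ≠ 0 := PadicInt.prime_p.ne_zero
    have : (p : ℤ_[p]) ∣ 1 := by
      rw [sq] at h3
      exact (mul_dvd_mul_iff_left h0).mp (by simpa using h3)
    exact PadicInt.prime_p.not_dvd_one this
  have := emultiplicity_eq_coe (a := (p : ℤ_[p])) (b := (γ : ℤ_[p]) - 1) (n := 1)
  exact this.mpr ⟨by simpa using h1, by simpa using h2⟩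

theorem norm_toCp (x : ℤ_[p]) : ‖toCp p x‖ = ‖x‖ := by
  rw [toCp, RingHom.comp_apply, norm_algebraMap']
  rfl

theorem val_toCp_of_emultiplicity {x : ℤ_[p]} {n : ℕ}
    (h : emultiplicity (p : ℤ_[p]) x = n) : toCp p x ≠ 0 ∧ val (toCp p x) = n := by
  obtain ⟨⟨y, rfl⟩, h2⟩ := emultiplicity_eq_coe.mp h
  have hy : ‖y‖ = 1 := by
    refine le_antisymm (PadicInt.norm_le_one _) (not_lt.mp fun hlt => h2 ?_)
    rw [PadicInt.norm_lt_one_iff_dvd] at hlt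
    rw [pow_succ]
    exact mul_dvd_mul_left _ hlt
  have hp1 : (1 : ℝ) < p := by exact_mod_cast hp.out.one_lt
  have hn : ‖toCp p ((p : ℤ_[p]) ^ n * y)‖ = ((p : ℝ) ^ n)⁻¹ := by
    rw [norm_toCp, norm_mul, hy, mul_one, norm_pow, PadicInt.norm_p, inv_pow]
  refine ⟨norm_pos_iff.mp (by rw [hn]; positivity), ?_⟩
  rw [val, hn, Real.logb_inv, neg_neg, Real.logb_pow, Real.logb_self_eq_one hp1, mul_one]

/-- `v_p(w_k) = 1 + v_p(k)` for `p` odd and `k ≥ 1`. -/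
theorem val_intCoord (hodd : Odd p) {γ : ℤ_[p]ˣ} (hγ : IsTopGenerator p γ) {k : ℕ} (hk : k ≠ 0) :
    toCp p (intCoord γ k) ≠ 0 ∧ val (toCp p (intCoord γ k)) = 1 + padicValNat p k := by
  have hg := emultiplicity_topGenerator hodd hγ
  have hd : (p : ℤ_[p]) ∣ (γ : ℤ_[p]) - 1 := by
    have := pow_dvd_of_le_emultiplicity (k := 1) (by rw [hg]; rfl)
    simpa using this
  have h := emultiplicity_pow_sub_one hodd hd hk
  rw [hg] at h
  have := val_toCp_of_emultiplicity (n := 1 + padicValNat p k) (by rw [h]; push_cast; rfl)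
  simpa [intCoord] using this

theorem toCp_injective : Function.Injective (toCp p) := by
  refine (injective_iff_map_eq_zero _).mpr fun x hx => ?_
  rw [← norm_eq_zero, ← norm_toCp, hx, norm_zero]

theorem mem_intWeights_iff (k : ℤ) :
    k ∈ intWeights (EvenWeight.ofInt p 0 Even.zero).tame ↔
      Even k ∧ ∀ u ∈ CommGroup.torsion ℤ_[p]ˣ, u ^ k = 1 := by
  have hinj : Function.Injective (Units.map (toCp p).toMonoidHom) :=
    Units.map_injective toCp_injective
  have key : ∀ (k : ℤ) (u : ℤ_[p]ˣ), zpowChar p k u = Units.map (toCp p).toMonoidHom (u ^ k) := by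
    intro k u
    rw [map_zpow]
    rfl
  rw [intWeights, Set.mem_ofPred_eq]
  constructor
  · rintro ⟨hk, h⟩
    refine ⟨hk, fun u hu => ?_⟩
    have h1 := DFunLike.congr_fun h ⟨u, hu⟩
    change zpowChar p k u = zpowChar p 0 u at h1
    rw [key, key] at h1
    simpa using hinj h1
  · rintro ⟨hk, h⟩
    refine ⟨hk, MonoidHom.ext fun u => ?_⟩
    change zpowChar p k u = zpowChar p 0 u
    rw [key, key, h u u.2, zpow_zero]

/-- By Fermat `u ^ (p - 1)` lies in `1 + pℤ_p`, where the only torsion element is `1`. -/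
theorem torsion_pow_eq_one (hodd : Odd p) {u : ℤ_[p]ˣ} (hu : u ∈ CommGroup.torsion ℤ_[p]ˣ) :
    u ^ (p - 1) = 1 := by
  obtain ⟨n, hn, h⟩ := isOfFinOrder_iff_pow_eq_one.mp hu
  have h1 : (p : ℤ_[p]) ∣ ((u ^ (p - 1) : ℤ_[p]ˣ) : ℤ_[p]) - 1 := by
    rw [← Ideal.mem_span_singleton, ← PadicInt.maximalIdeal_eq_span_p, ← PadicInt.ker_toZMod,
      RingHom.mem_ker, map_sub, map_one, Units.val_pow_eq_pow_val, map_pow, sub_eq_zero]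
    refine ZMod.pow_card_sub_one_eq_one ?_
    exact (u.isUnit.map PadicInt.toZMod).ne_zero
  refine Units.ext (eq_one_of_pow_eq_one hodd h1 hn.ne' ?_)
  rw [← Units.val_pow_eq_pow_val, ← pow_mul, mul_comm, pow_mul, h, one_pow, Units.val_one]

theorem intWeights_three [Fact (Nat.Prime 3)] :
    intWeights (EvenWeight.ofInt 3 0 Even.zero).tame = {k : ℤ | (2 : ℤ) ∣ k} := by
  ext k
  rw [mem_intWeights_iff, Set.mem_ofPred_eq, ← even_iff_two_dvd]
  refine ⟨fun h => h.1, fun h => ⟨h, fun u hu => ?_⟩⟩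
  obtain ⟨m, rfl⟩ := even_iff_two_dvd.mp h
  have := torsion_pow_eq_one (p := 3) (by decide) hu
  rw [zpow_mul]
  norm_cast
  rw [this, one_zpow]

/-- A root of unity of order 4 in `ℤ_5`: it detects the class of an even weight modulo 4. Hensel
applies at `2`, since `2 ^ 2 + 1 = 5` and the derivative `4` is a unit. -/
theorem exists_sq_eq_neg_one [Fact (Nat.Prime 5)] : ∃ z : ℤ_[5], z ^ 2 = -1 := by
  let F : Polynomial ℤ_[5] := Polynomial.X ^ 2 + 1
  have h5 : ‖(5 : ℤ_[5])‖ = 5⁻¹ := by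
    have := PadicInt.norm_p (p := 5)
    simpa using this
  have h4 : ‖(4 : ℤ_[5])‖ = 1 := by
    refine le_antisymm (PadicInt.norm_le_one _) (not_lt.mp fun h => ?_)
    have := (PadicInt.norm_intCast_lt_one_iff (p := 5) (z := 4)).mp (by exact_mod_cast h)
    revert this; decide
  obtain ⟨z, hz, -⟩ := hensels_lemma (p := 5) (R := ℤ_[5]) (F := F) (a := 2) (by
    simp only [F, Polynomial.coe_aeval_eq_eval, Polynomial.eval_add, Polynomial.eval_pow,
      Polynomial.eval_X, Polynomial.eval_one, Polynomial.derivative_add, Polynomial.derivative_one,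
      Polynomial.derivative_X_pow, add_zero, Polynomial.eval_mul, Polynomial.eval_C]
    norm_num [h5, h4])
  refine ⟨z, ?_⟩
  simpa [F, add_eq_zero_iff_eq_neg] using hz

theorem intWeights_five [Fact (Nat.Prime 5)] :
    intWeights (EvenWeight.ofInt 5 0 Even.zero).tame = {k : ℤ | (4 : ℤ) ∣ k} := by
  ext k
  rw [mem_intWeights_iff, Set.mem_ofPred_eq]
  constructor
  · rintro ⟨⟨m, rfl⟩, h⟩
    obtain ⟨z, hz⟩ := exists_sq_eq_neg_one
    have hz4 : z * (-z) = 1 := by linear_combination -hz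
    let u : ℤ_[5]ˣ := ⟨z, -z, hz4, by rw [mul_comm, hz4]⟩
    have hu2 : u ^ 2 = -1 := Units.ext hz
    have hu : u ∈ CommGroup.torsion ℤ_[5]ˣ :=
      isOfFinOrder_iff_pow_eq_one.mpr ⟨4, by norm_num, by
        rw [show 4 = 2 * 2 from rfl, pow_mul, hu2, neg_one_sq]⟩
    have h1 := h u hu
    rw [← two_mul, zpow_mul] at h1
    norm_cast at h1
    rw [hu2] at h1
    rcases Int.even_or_odd m with he | ho
    · obtain ⟨j, rfl⟩ := he
      exact ⟨j, by ring⟩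
    · rw [ho.neg_one_zpow] at h1
      have h2 := congrArg (Units.val) h1
      simp only [Units.val_neg, Units.val_one] at h2
      norm_num [neg_eq_iff_add_eq_zero] at h2
  · rintro ⟨m, rfl⟩
    refine ⟨⟨2 * m, by ring⟩, fun u hu => ?_⟩
    have := torsion_pow_eq_one (p := 5) (by decide) hu
    rw [zpow_mul]
    norm_cast
    rw [this, one_zpow]

end Padic

end Ghost
end

noncomputable section
namespace Ghost

/-! ### Newton polygons of series with convex coefficient valuations -/

section Newton

variable {p : ℕ} [Fact p.Prime]

/-- Convexity: the line through `(i, y i)` with slope the next increment supports the sequence on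
both sides. -/
theorem le_of_monotone_sub {y : ℕ → ℝ} (hy : Monotone fun i => y (i + 1) - y i) (i j : ℕ) :
    y i + (y (i + 1) - y i) * ((j : ℝ) - i) ≤ y j := by
  rcases le_total i j with h | h
  · obtain ⟨n, rfl⟩ := Nat.exists_eq_add_of_le h
    clear h
    induction n with
    | zero => simp
    | succ n ih =>
      have := hy (Nat.le_add_right i n)
      simp only [← add_assoc] at *
      push_cast at *
      linarith
  · obtain ⟨n, rfl⟩ := Nat.exists_eq_add_of_le h
    clear h
    induction n generalizing j with
    | zero => simp
    | succ n ih =>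
      have h1 := ih (j + 1)
      have h2 := hy (show j ≤ j + 1 + n by omega)
      simp only [show j + (n + 1) = j + 1 + n by ring] at *
      push_cast at *
      linarith

theorem newtonPolygon_eq {P : PowerSeries ℂ_[p]} {y : ℕ → ℝ} (h0 : ∀ i, P.coeff i ≠ 0)
    (hv : ∀ i, val (P.coeff i) = y i) (hy : Monotone fun i => y (i + 1) - y i) (i : ℕ) :
    newtonPolygon P i = y i := by
  refine le_antisymm (iInf₂_le (y i) (subset_convexHull ℝ (newtonPoints P) ⟨i, h0 i, by rw [hv]⟩)) ?_
  refine le_iInf₂ fun t ht => ?_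
  -- The half-plane above the supporting line at `i` is convex and contains all the points, hence
  -- the hull; over the abscissa `i` it says `y i ≤ t`.
  have hsub : convexHull ℝ (newtonPoints P) ⊆
      {q : ℝ × ℝ | y i + (y (i + 1) - y i) * (q.1 - i) ≤ q.2} := by
    refine convexHull_min ?_ ?_
    · rintro q ⟨j, -, rfl⟩
      rw [Set.mem_ofPred_eq, hv]
      exact le_of_monotone_sub hy i j
    · intro a ha b hb s t hs ht hst
      rw [Set.mem_ofPred_eq] at *
      simp only [Prod.fst_add, Prod.smul_fst, smul_eq_mul, Prod.snd_add, Prod.smul_snd]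
      obtain rfl : t = 1 - s := by linarith
      linarith [mul_le_mul_of_nonneg_left ha hs, mul_le_mul_of_nonneg_left hb ht]
  have := hsub ht
  rw [Set.mem_ofPred_eq] at this
  rw [EReal.coe_le_coe_iff]
  simpa using this

theorem newtonSlope_eq {P : PowerSeries ℂ_[p]} {y : ℕ → ℝ} (h0 : ∀ i, P.coeff i ≠ 0)
    (hv : ∀ i, val (P.coeff i) = y i) (hy : Monotone fun i => y (i + 1) - y i) (i : ℕ) :
    newtonSlope P (i + 1) = ((y (i + 1) - y i : ℝ) : EReal) := by
  rw [newtonSlope, newtonPolygon_eq h0 hv hy, show ((i + 1 : ℕ) : ℝ) - 1 = (i : ℝ) by simp,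
    newtonPolygon_eq h0 hv hy, EReal.coe_sub]

end Newton

/-! ### Sums of valuations over the zeros -/

section Combinatorics

open Nat

theorem sum_Ico_one_add_padicValNat (p : ℕ) [Fact p.Prime] {a b : ℕ} (hab : a ≤ b) :
    ∑ n ∈ Finset.Ico (a + 1) (b + 1), ((1 : ℤ) + padicValNat p n) =
      b - a + padicValNat p b ! - padicValNat p a ! := by
  induction b, hab using Nat.le_induction with
  | base => simp
  | succ b hb ih =>
    rw [Finset.sum_Ico_succ_top (by omega), ih, Nat.factorial_succ,
      padicValNat.mul (by omega) (Nat.factorial_ne_zero _)]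
    push_cast
    ring

theorem padicValNat_factorial_add (p : ℕ) [Fact p.Prime] (m r : ℕ) (hr : r < p) :
    padicValNat p (p * m + r)! = padicValNat p m ! + m := by
  rw [padicValNat_factorial_mul_add m hr, padicValNat_factorial_mul]

theorem padicValNat_mul_of_not_dvd (p : ℕ) [Fact p.Prime] {c : ℕ} (hc : ¬ p ∣ c) (n : ℕ) :
    padicValNat p (c * n) = padicValNat p n := by
  rcases eq_or_ne n 0 with rfl | hn
  · simp
  · rw [padicValNat.mul (by rintro rfl; simp at hc) hn, padicValNat.eq_zero_of_not_dvd hc, zero_add]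

/-- The factorials of `c(j+1)` and `c(j+1) - 1` differ by the factor `c(j+1)`, whose valuation is
that of `j + 1 = (j+1)!/j!`. -/
theorem padicValNat_factorial_mul_pred (p : ℕ) [Fact p.Prime] {c : ℕ} (hc : ¬ p ∣ c) (j : ℕ) :
    padicValNat p (c * j + c - 1)! + padicValNat p (j + 1)! =
      padicValNat p (c * (j + 1))! + padicValNat p j ! := by
  have hc0 : c ≠ 0 := by rintro rfl; simp at hc
  have h1 : c * (j + 1) = (c * j + c - 1) + 1 := by rw [mul_add]; omega
  have h2 : padicValNat p (c * (j + 1))! =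
      padicValNat p (j + 1) + padicValNat p (c * j + c - 1)! := by
    rw [← padicValNat_mul_of_not_dvd p hc (j + 1), h1, Nat.factorial_succ,
      padicValNat.mul (by omega) (Nat.factorial_ne_zero _)]
  rw [h2, Nat.factorial_succ, padicValNat.mul (by omega) (Nat.factorial_ne_zero _)]
  ring

theorem padicValRat_factorial_div (p : ℕ) [Fact p.Prime] (a b : ℕ) :
    padicValRat p ((a ! : ℚ) / (b ! : ℚ)) = padicValNat p a ! - padicValNat p b ! := by
  rw [padicValRat.div (by exact_mod_cast Nat.factorial_ne_zero _)
    (by exact_mod_cast Nat.factorial_ne_zero _), padicValRat.of_nat, padicValRat.of_nat]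

theorem sum_range_ite_Ico {a b N : ℕ} (hb : b ≤ N) (f : ℕ → ℤ) :
    ∑ n ∈ Finset.range N, (if a ≤ n ∧ n < b then (1 : ℤ) else 0) * f n =
      ∑ n ∈ Finset.Ico a b, f n := by
  simp only [ite_mul, one_mul, zero_mul]
  rw [← Finset.sum_filter]
  congr 1
  ext n
  simp only [Finset.mem_filter, Finset.mem_range, Finset.mem_Ico]
  omega

/-- `dim S_{2n}(SL₂(ℤ))`. -/
def cuspDimThree (n : ℕ) : ℕ := if n % 6 = 1 then n / 6 - 1 else n / 6

/-- The hill climbs while `2t < l`, is flat at `2t = l`, and descends for `2t > l` until it reaches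
zero. -/
theorem hill_add_one (l t : ℤ) :
    (hill l (t + 1) : ℤ) = hill l t + (if 0 ≤ t ∧ 2 * t + 1 ≤ l then 1 else 0) -
      (if 0 ≤ t ∧ l + 1 ≤ 2 * t ∧ t ≤ l then 1 else 0) := by
  rw [hill, hill]
  split_ifs <;> omega

/-- Put `d = cuspDimThree n`, `t = j - d` and `l = ⌊2n/3⌋ - 2 - 2d` (up to truncation at small `n`).
In `2t + 1 ≤ l` and `l + 1 ≤ 2t` the `d` cancels, leaving `n ≥ 3j + 5` and `n < 3j + 3`. The
condition `t ≤ l` reads `⌈n/2⌉ ≥ j + 2`. The condition `d ≤ j` means `n < 6j + 6` or `n = 6j + 7`,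
the latter because the dimension drops when `n ≡ 1` mod 6. -/
theorem hill_three_succ (j n : ℕ) :
    (hill (((2 * n / 3 - 1 - 2 * cuspDimThree n : ℕ) : ℤ) - 1)
        (((j + 1 : ℕ) : ℤ) - cuspDimThree n) : ℤ) =
      hill (((2 * n / 3 - 1 - 2 * cuspDimThree n : ℕ) : ℤ) - 1) ((j : ℤ) - cuspDimThree n) +
      (if 3 * j + 5 ≤ n ∧ n < 6 * j + 6 then 1 else 0) +
      (if 6 * j + 7 ≤ n ∧ n < 6 * j + 8 then 1 else 0) -
      (if 2 * j + 3 ≤ n ∧ n < 3 * j + 3 then 1 else 0) := by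
  rw [show ((j + 1 : ℕ) : ℤ) - cuspDimThree n = ((j : ℤ) - cuspDimThree n) + 1 by push_cast; ring,
    hill_add_one, add_assoc]
  obtain ⟨q, r, hr, rfl⟩ : ∃ q r, r < 6 ∧ n = 6 * q + r := ⟨n / 6, n % 6, by omega, by omega⟩
  have hd : cuspDimThree (6 * q + r) = if r = 1 then q - 1 else q := by
    rw [cuspDimThree, show (6 * q + r) % 6 = r by omega, show (6 * q + r) / 6 = q by omega]
  rw [hd]
  refine congrArg₂ _ (congrArg₂ _ rfl ?_) ?_ <;> clear hd <;>
  split_ifs <;> interval_cases r <;> omega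

/-- Here `l = 2n - 2 - 2⌊n/3⌋` and `t = j - ⌊n/3⌋` for `n ≥ 1`. Climbing means `n ≥ j + 2`,
descending means `n ≤ j`, `t ≥ 0` means `n < 3j + 3`, and `t ≤ l` means `5n > 3(j + 1)`. -/
theorem hill_five_succ (j n : ℕ) :
    (hill (((2 * n - 1 - 2 * (n / 3) : ℕ) : ℤ) - 1) (((j + 1 : ℕ) : ℤ) - ((n / 3 : ℕ) : ℤ)) : ℤ) =
      hill (((2 * n - 1 - 2 * (n / 3) : ℕ) : ℤ) - 1) ((j : ℤ) - ((n / 3 : ℕ) : ℤ)) +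
      (if j + 2 ≤ n ∧ n < 3 * j + 3 then 1 else 0) -
      (if 3 * (j + 1) / 5 + 1 ≤ n ∧ n < j + 1 then 1 else 0) := by
  rw [show ((j + 1 : ℕ) : ℤ) - ((n / 3 : ℕ) : ℤ) = ((j : ℤ) - ((n / 3 : ℕ) : ℤ)) + 1 by
    push_cast; ring, hill_add_one]
  refine congrArg₂ _ (congrArg₂ _ rfl ?_) ?_ <;> split_ifs <;> omega

theorem sum_hill_three (j N : ℕ) (hN : 6 * j + 8 ≤ N) :
    ∑ n ∈ Finset.range N, (hill (((2 * n / 3 - 1 - 2 * cuspDimThree n : ℕ) : ℤ) - 1)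
        (((j + 1 : ℕ) : ℤ) - cuspDimThree n) : ℤ) * (1 + padicValNat 3 n) =
      ∑ n ∈ Finset.range N, (hill (((2 * n / 3 - 1 - 2 * cuspDimThree n : ℕ) : ℤ) - 1)
        ((j : ℤ) - cuspDimThree n) : ℤ) * (1 + padicValNat 3 n) +
      (2 * (j + 1) + 2 * (padicValNat 3 (2 * (j + 1))! - padicValNat 3 (j + 1)!)) := by
  simp only [hill_three_succ, add_mul, sub_mul, Finset.sum_add_distrib, Finset.sum_sub_distrib]
  rw [sum_range_ite_Ico (by omega), sum_range_ite_Ico (by omega), sum_range_ite_Ico (by omega)]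
  have : Fact (Nat.Prime 3) := ⟨Nat.prime_three⟩
  rw [sum_Ico_one_add_padicValNat 3 (a := 3 * j + 4) (b := 6 * j + 5) (by omega),
    sum_Ico_one_add_padicValNat 3 (a := 6 * j + 6) (b := 6 * j + 7) (by omega),
    sum_Ico_one_add_padicValNat 3 (a := 2 * j + 2) (b := 3 * j + 2) (by omega)]
  -- Every endpoint factorial except `(2j+2)!` has the form `(3m+r)!`. The linear terms produced by
  -- reducing to `m!` cancel, and `h6` exchanges `(2j+1)!/j!` for `(2j+2)!/(j+1)!`.
  have h1 := padicValNat_factorial_add 3 (j + 1) 1 (by norm_num)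
  have h2 := padicValNat_factorial_add 3 (2 * j + 1) 2 (by norm_num)
  have h3 := padicValNat_factorial_add 3 (2 * j + 2) 0 (by norm_num)
  have h4 := padicValNat_factorial_add 3 (2 * j + 2) 1 (by norm_num)
  have h5 := padicValNat_factorial_add 3 j 2 (by norm_num)
  have h6 := padicValNat_factorial_mul_pred 3 (c := 2) (by norm_num) j
  rw [show 3 * (j + 1) + 1 = 3 * j + 4 by ring] at h1
  rw [show 3 * (2 * j + 1) + 2 = 6 * j + 5 by ring] at h2
  rw [show 3 * (2 * j + 2) + 0 = 6 * j + 6 by ring] at h3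
  rw [show 3 * (2 * j + 2) + 1 = 6 * j + 7 by ring] at h4
  rw [show 2 * (j + 1) = 2 * j + 2 by ring, show 2 * j + 2 - 1 = 2 * j + 1 by omega] at h6
  rw [show 2 * (j + 1) = 2 * j + 2 by ring]
  simp only [Nat.cast_add, Nat.cast_mul, Nat.cast_ofNat]
  omega

theorem sum_hill_five (j N : ℕ) (hN : 3 * j + 3 ≤ N) :
    ∑ n ∈ Finset.range N, (hill (((2 * n - 1 - 2 * (n / 3) : ℕ) : ℤ) - 1)
        (((j + 1 : ℕ) : ℤ) - ((n / 3 : ℕ) : ℤ)) : ℤ) * (1 + padicValNat 5 n) =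
      ∑ n ∈ Finset.range N, (hill (((2 * n - 1 - 2 * (n / 3) : ℕ) : ℤ) - 1)
        ((j : ℤ) - ((n / 3 : ℕ) : ℤ)) : ℤ) * (1 + padicValNat 5 n) +
      ((j + 1) + 2 * (padicValNat 5 (3 * (j + 1))! - padicValNat 5 (j + 1)!)) := by
  simp only [hill_five_succ, add_mul, sub_mul, Finset.sum_add_distrib, Finset.sum_sub_distrib]
  rw [sum_range_ite_Ico (by omega), sum_range_ite_Ico (by omega)]
  have : Fact (Nat.Prime 5) := ⟨Nat.prime_five⟩
  -- The lower end of the negative interval is `c = ⌊3(j+1)/5⌋`, so `v_5(c!) + c` is the valuation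
  -- of `(3(j+1))!`; this supplies one of its two copies in the slope.
  obtain ⟨c, r, hr, hc⟩ : ∃ c r, r < 5 ∧ 3 * (j + 1) = 5 * c + r :=
    ⟨3 * (j + 1) / 5, 3 * (j + 1) % 5, by omega, by omega⟩
  rw [show 3 * (j + 1) / 5 = c by omega,
    sum_Ico_one_add_padicValNat 5 (a := j + 1) (b := 3 * j + 2) (by omega),
    sum_Ico_one_add_padicValNat 5 (a := c) (b := j) (by omega)]
  have h1 := padicValNat_factorial_add 5 c r hr
  rw [← hc] at h1
  have h6 := padicValNat_factorial_mul_pred 5 (c := 3) (by norm_num) j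
  rw [show 3 * j + 3 - 1 = 3 * j + 2 by omega] at h6
  simp only [Nat.cast_add, Nat.cast_mul, Nat.cast_ofNat]
  omega

end Combinatorics

end Ghost
end

noncomputable section
namespace Ghost

/-! ### The Petersson product is definite, and the dimension of the new part -/

section Petersson

open UpperHalfPlane MeasureTheory
open scoped Manifold

/-- The density `1 / y ^ 2` never vanishes, so a null set for the hyperbolic measure is Lebesgue
null. -/
instance : Measure.IsOpenPosMeasure (volume : Measure ℍ) where
  open_pos U hU hne h := by
    rw [UpperHalfPlane.volume_eq_lintegral] at h
    have hU' : IsOpen (UpperHalfPlane.coe '' U) := isOpenEmbedding_coe.isOpenMap U hU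
    have hm : Measurable fun z : ℂ => (((1 / ‖z.im‖₊) ^ 2 : NNReal) : ENNReal) := by fun_prop
    rw [setLIntegral_eq_zero_iff hU'.measurableSet hm] at h
    have h2 : volume (UpperHalfPlane.coe '' U) = 0 := by
      rw [← compl_compl (UpperHalfPlane.coe '' U), ← mem_ae_iff]
      filter_upwards [h] with z hz hzU
      obtain ⟨τ, -, rfl⟩ := id hzU
      have := hz hzU
      have hpos : τ.im ≠ 0 := τ.im_pos.ne'
      simp_all
    exact (hU'.measure_pos volume (hne.image _)).ne' h2

theorem isOpen_fdo : IsOpen (𝒟ᵒ : Set ℍ) := by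
  have h1 : Continuous fun τ : ℍ => Complex.normSq (τ : ℂ) :=
    Complex.continuous_normSq.comp continuous_coe
  have h2 : Continuous fun τ : ℍ => |τ.re| := continuous_abs.comp continuous_re
  exact (isOpen_lt continuous_const h1).inter (isOpen_lt h2 continuous_const)

theorem fdo_nonempty : (𝒟ᵒ : Set ℍ).Nonempty := by
  refine ⟨⟨2 * Complex.I, by simp⟩, ?_⟩
  constructor
  · simp [Complex.normSq_apply]; norm_num
  · change |(2 * Complex.I).re| < 1 / 2
    simp

theorem eq_zero_of_eq_zero_on_open {f : ℍ → ℂ} (hf : MDiff f) {U : Set ℍ} (hU : IsOpen U)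
    (hne : U.Nonempty) (h : ∀ τ ∈ U, f τ = 0) : f = 0 := by
  obtain ⟨τ₀, hτ₀⟩ := hne
  have hd := UpperHalfPlane.mdifferentiable_iff.mp hf
  have hpre : IsPreconnected {z : ℂ | 0 < z.im} :=
    (convex_halfSpace_im_gt 0).isPreconnected
  have hev : (f ∘ ofComplex) =ᶠ[nhds (τ₀ : ℂ)] 0 := by
    have := (isOpenEmbedding_coe.isOpenMap U hU).mem_nhds ⟨τ₀, hτ₀, rfl⟩
    filter_upwards [this]
    rintro _ ⟨τ, hτ, rfl⟩
    simp [h τ hτ]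
  have := (hd.analyticOnNhd isOpen_upperHalfPlaneSet).eqOn_zero_of_preconnected_of_eventuallyEq_zero
    hpre τ₀.im_pos hev
  ext τ
  simpa using this τ.im_pos

variable {M : ℕ} [NeZero M] {k : ℤ}

theorem petersson_self (f : ℍ → ℂ) (τ : ℍ) :
    petersson k f f τ = ((‖f τ‖ ^ 2 * τ.im ^ k : ℝ) : ℂ) := by
  rw [petersson, ← Complex.normSq_eq_conj_mul_self, Complex.normSq_eq_norm_sq]
  push_cast
  rfl

theorem peterssonProduct_self (f : CuspSpace M k) :
    peterssonProduct M k f f = ((∑ᶠ γ : SL(2, ℤ) ⧸ CongruenceSubgroup.Gamma0 M,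
      ∫ τ in 𝒟, ‖f (γ.out⁻¹ • τ)‖ ^ 2 * (γ.out⁻¹ • τ).im ^ k : ℝ) : ℂ) := by
  have := AddMonoidHom.map_finsum (Complex.ofRealHom : ℝ →+ ℂ)
    (f := fun γ : SL(2, ℤ) ⧸ CongruenceSubgroup.Gamma0 M =>
      ∫ τ in 𝒟, ‖f (γ.out⁻¹ • τ)‖ ^ 2 * (γ.out⁻¹ • τ).im ^ k) (Set.toFinite _)
  refine Eq.trans (finsum_congr fun γ => ?_) this.symm
  simp only [petersson_self]
  exact integral_ofReal

theorem peterssonProduct_conj_symm (f g : CuspSpace M k) :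
    (starRingEnd ℂ) (peterssonProduct M k g f) = peterssonProduct M k f g := by
  rw [peterssonProduct, peterssonProduct]
  have := AddMonoidHom.map_finsum (starRingEnd ℂ : ℂ →+ ℂ)
    (f := fun γ : SL(2, ℤ) ⧸ CongruenceSubgroup.Gamma0 M =>
      ∫ τ in 𝒟, petersson k g f (γ.out⁻¹ • τ)) (Set.toFinite _)
  refine this.trans (finsum_congr fun γ => ?_)
  refine (integral_conj (𝕜 := ℂ)).symm.trans ?_
  refine integral_congr_ae (.of_forall fun τ => ?_)
  simp only [petersson, map_mul, map_zpow₀, Complex.conj_ofReal, Complex.conj_conj]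
  ring

/-- All coset terms are nonnegative, so a single one already vanishes. Its integrand is continuous,
hence zero on the open fundamental domain, and the identity theorem spreads this to the whole
half-plane. -/
theorem peterssonProduct_self_definite (f : CuspSpace M k) (h : peterssonProduct M k f f = 0) :
    f = 0 := by
  rw [peterssonProduct_self, Complex.ofReal_eq_zero] at h
  let γ₀ : SL(2, ℤ) ⧸ CongruenceSubgroup.Gamma0 M := QuotientGroup.mk 1
  have hnn : ∀ (γ : SL(2, ℤ) ⧸ CongruenceSubgroup.Gamma0 M) (τ : ℍ),
      0 ≤ ‖f (γ.out⁻¹ • τ)‖ ^ 2 * (γ.out⁻¹ • τ).im ^ k :=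
    fun γ τ => mul_nonneg (sq_nonneg _) (zpow_nonneg (γ.out⁻¹ • τ).im_pos.le _)
  have h0 : ∫ τ in 𝒟, ‖f (γ₀.out⁻¹ • τ)‖ ^ 2 * (γ₀.out⁻¹ • τ).im ^ k = 0 := by
    refine le_antisymm ?_ (integral_nonneg (hnn _))
    rw [← h]
    exact single_le_finsum (f := fun γ : SL(2, ℤ) ⧸ CongruenceSubgroup.Gamma0 M =>
      ∫ τ in 𝒟, ‖f (γ.out⁻¹ • τ)‖ ^ 2 * (γ.out⁻¹ • τ).im ^ k) γ₀ (Set.toFinite _)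
      (fun γ => integral_nonneg (hnn γ))
  have hint : IntegrableOn (fun τ => ‖f (γ₀.out⁻¹ • τ)‖ ^ 2 * (γ₀.out⁻¹ • τ).im ^ k) 𝒟 := by
    have := (integrableOn_petersson M k f f γ₀.out⁻¹).re
    refine this.congr (.of_forall fun τ => ?_)
    dsimp only
    rw [petersson_self]
    exact Complex.ofReal_re _
  rw [setIntegral_eq_zero_iff_of_nonneg_ae (.of_forall (hnn _)) hint] at h0
  have hc : Continuous fun τ : ℍ => ‖f (γ₀.out⁻¹ • τ)‖ ^ 2 * (γ₀.out⁻¹ • τ).im ^ k := by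
    have hγ : Continuous fun τ : UpperHalfPlane => γ₀.out⁻¹ • τ :=
      continuous_const_smul (Matrix.SpecialLinearGroup.mapGL ℝ γ₀.out⁻¹)
    have hf := (CuspFormClass.holo f).continuous
    exact ((hf.comp hγ).norm.pow 2).mul
      ((continuous_im.comp hγ).zpow₀ k fun τ => Or.inl (γ₀.out⁻¹ • τ).im_pos.ne')
  have h1 : ∀ τ ∈ 𝒟ᵒ, ‖f (γ₀.out⁻¹ • τ)‖ ^ 2 * (γ₀.out⁻¹ • τ).im ^ k = 0 := by
    have h2 := ae_restrict_of_ae_restrict_of_subset (ModularGroup.fdo_subset_fd) h0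
    have := Measure.eqOn_open_of_ae_eq h2 isOpen_fdo hc.continuousOn continuousOn_const
    exact this
  have hγ' : Continuous fun τ : UpperHalfPlane => γ₀.out • τ :=
    continuous_const_smul (Matrix.SpecialLinearGroup.mapGL ℝ γ₀.out)
  have hγ : Continuous fun τ : UpperHalfPlane => γ₀.out⁻¹ • τ :=
    continuous_const_smul (Matrix.SpecialLinearGroup.mapGL ℝ γ₀.out⁻¹)
  have := eq_zero_of_eq_zero_on_open (CuspFormClass.holo f) (isOpen_fdo.preimage hγ')
    (by
      obtain ⟨τ, hτ⟩ := fdo_nonempty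
      exact ⟨γ₀.out⁻¹ • τ, by simpa using hτ⟩)
    (fun τ hτ => by
      have := h1 _ hτ
      rw [inv_smul_smul] at this
      have h3 : τ.im ^ k ≠ 0 := zpow_ne_zero _ τ.im_pos.ne'
      simpa [h3] using this)
  exact DFunLike.coe_injective this

/-- The Petersson product as an inner product on `S_k(Γ₀(M))`. -/
@[reducible]
def peterssonCore (M : ℕ) [NeZero M] (k : ℤ) : InnerProductSpace.Core ℂ (CuspSpace M k) where
  inner := peterssonProduct M k
  conj_inner_symm := peterssonProduct_conj_symm
  re_inner_nonneg f := by
    rw [peterssonProduct_self]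
    refine finsum_nonneg fun γ => integral_nonneg fun τ => ?_
    exact mul_nonneg (sq_nonneg _) (zpow_nonneg (γ.out⁻¹ • τ).im_pos.le _)
  add_left := peterssonProduct_add M k
  smul_left f g c := peterssonProduct_smul M k c f g
  definite := peterssonProduct_self_definite

/-- With the Petersson product as inner product, `pNew` is by definition the orthogonal complement
of `pOld`. -/
theorem finrank_pOld_add_finrank_pNew (N p : ℕ) [NeZero N] [NeZero p] (k : ℤ)
    [FiniteDimensional ℂ (CuspSpace (N * p) k)] :
    Module.finrank ℂ (pOld N p k) + Module.finrank ℂ (pNew N p k) =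
      Module.finrank ℂ (CuspSpace (N * p) k) := by
  let core :=  peterssonCore (N * p) k
  let : NormedAddCommGroup (CuspSpace (N * p) k) := core.toNormedAddCommGroup
  let : InnerProductSpace ℂ (CuspSpace (N * p) k) := .ofCore core.toCore
  have : pNew N p k = (pOld N p k)ᗮ := by
    ext h
    rw [Submodule.mem_orthogonal']
    rfl
  rw [this]
  exact Submodule.finrank_add_finrank_orthogonal _

end Petersson

end Ghost
end

noncomputable section
namespace Ghost

/-! ### Cosets of `Γ₀(p)` -/

section UpperBound

open UpperHalfPlane ModularForm ModularGroup Asymptotics Filter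
open CongruenceSubgroup (Gamma0 Gamma0_mem)
open scoped Manifold

theorem mem_Gamma0_iff_dvd {M : ℕ} {g : SL(2, ℤ)} : g ∈ Gamma0 M ↔ (M : ℤ) ∣ g 1 0 := by
  rw [Gamma0_mem, ZMod.intCast_zmod_eq_zero_iff_dvd]

theorem SL_mul_apply (a b : SL(2, ℤ)) (i j : Fin 2) :
    (a * b) i j = a i 0 * b 0 j + a i 1 * b 1 j := by
  rw [Matrix.SpecialLinearGroup.coe_mul, Matrix.mul_apply, Fin.sum_univ_two]

theorem SL_inv_apply (g : SL(2, ℤ)) :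
    g⁻¹ 0 0 = g 1 1 ∧ g⁻¹ 0 1 = -g 0 1 ∧ g⁻¹ 1 0 = -g 1 0 ∧ g⁻¹ 1 1 = g 0 0 := by
  rw [Matrix.SpecialLinearGroup.SL2_inv_expl]
  exact ⟨rfl, rfl, rfl, rfl⟩

theorem T_zpow_apply (j : ℤ) : (T ^ j) 0 0 = 1 ∧ (T ^ j) 0 1 = j ∧ (T ^ j) 1 0 = 0 ∧
    (T ^ j) 1 1 = 1 := by
  rw [coe_T_zpow]
  exact ⟨rfl, rfl, rfl, rfl⟩

theorem S_apply : S 0 0 = 0 ∧ S 0 1 = -1 ∧ S 1 0 = 1 ∧ S 1 1 = 0 :=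
  ⟨rfl, rfl, rfl, rfl⟩

theorem T_zpow_mul_S_apply (j : ℤ) : (T ^ j * S) 0 0 = j ∧ (T ^ j * S) 1 0 = 1 := by
  obtain ⟨t1, t2, t3, t4⟩ := T_zpow_apply j
  obtain ⟨s1, s2, s3, s4⟩ := S_apply
  simp only [SL_mul_apply, t1, t2, t3, t4, s1, s3]
  constructor <;> ring

theorem T_zpow_mul_S_inv_mul_apply (j : ℤ) (g : SL(2, ℤ)) :
    ((T ^ j * S)⁻¹ * g) 1 0 = j * g 1 0 - g 0 0 := by
  obtain ⟨-, -, h3, h4⟩ := SL_inv_apply (T ^ j * S)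
  obtain ⟨t1, t2⟩ := T_zpow_mul_S_apply j
  rw [SL_mul_apply, h3, h4, t1, t2]
  ring

theorem exists_dvd_mul_sub {p : ℕ} (hp : p.Prime) {a c : ℤ} (hc : ¬ (p : ℤ) ∣ c) :
    ∃ j : Fin p, (p : ℤ) ∣ j * c - a := by
  have := Fact.mk hp
  have hc' : (c : ZMod p) ≠ 0 := by rwa [Ne, ZMod.intCast_zmod_eq_zero_iff_dvd]
  refine ⟨⟨((a : ZMod p) / c).val, ZMod.val_lt _⟩, ?_⟩
  rw [← ZMod.intCast_zmod_eq_zero_iff_dvd]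
  push_cast
  rw [ZMod.natCast_zmod_val, div_mul_cancel₀ _ hc', sub_self]

/-- The coset of `g` is the point `(g 0 0 : g 1 0)` of the projective line over `𝔽_p`; `j` is the
quotient `g 0 0 / g 1 0`. -/
theorem exists_coset_rep {p : ℕ} (hp : p.Prime) (g : SL(2, ℤ)) :
    g ∈ Gamma0 p ∨ ∃ j : Fin p, (T ^ (j : ℤ) * S)⁻¹ * g ∈ Gamma0 p := by
  by_cases hc : (p : ℤ) ∣ g 1 0
  · exact .inl (mem_Gamma0_iff_dvd.mpr hc)
  · obtain ⟨j, hj⟩ := exists_dvd_mul_sub hp (a := g 0 0) hc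
    exact .inr ⟨j, mem_Gamma0_iff_dvd.mpr (by rwa [T_zpow_mul_S_inv_mul_apply])⟩

/-- Representatives of `SL₂(ℤ) / Γ₀(p)`. -/
def cosetRep (p : ℕ) : Option (Fin p) → SL(2, ℤ)
  | none => 1
  | some j => T ^ (j : ℤ) * S

theorem index_Gamma0 {p : ℕ} (hp : p.Prime) : (Gamma0 p).index = p + 1 := by
  have hbij : Function.Bijective fun j : Option (Fin p) =>
      (QuotientGroup.mk (cosetRep p j) : SL(2, ℤ) ⧸ Gamma0 p) := by
    constructor
    · rintro (_ | i) (_ | j) h <;> have h := QuotientGroup.eq.mp h <;>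
        rw [mem_Gamma0_iff_dvd] at h
      · have h1 : ((cosetRep p none)⁻¹ * cosetRep p (some j)) = T ^ (j : ℤ) * S := by
          simp [cosetRep]
        rw [h1, (T_zpow_mul_S_apply _).2] at h
        exact absurd (by exact_mod_cast h) hp.not_dvd_one
      · have h1 : ((cosetRep p (some i))⁻¹ * cosetRep p none) = (T ^ (i : ℤ) * S)⁻¹ := by
          simp only [cosetRep, mul_one]
        rw [h1, (SL_inv_apply _).2.2.1, (T_zpow_mul_S_apply _).2, dvd_neg] at h
        exact absurd (by exact_mod_cast h) hp.not_dvd_one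
      · have h1 : ((cosetRep p (some i))⁻¹ * cosetRep p (some j)) =
          (T ^ (i : ℤ) * S)⁻¹ * (T ^ (j : ℤ) * S) := rfl
        rw [h1, T_zpow_mul_S_inv_mul_apply, (T_zpow_mul_S_apply _).1, (T_zpow_mul_S_apply _).2,
          mul_one] at h
        congr 1
        ext
        have h2 : |(i : ℤ) - j| < p := by
          rw [abs_lt]
          constructor <;> omega
        have := Int.eq_zero_of_abs_lt_dvd h h2
        omega
    · intro q
      induction q using QuotientGroup.induction_on with
      | H g =>
        rcases exists_coset_rep hp g with h | ⟨j, h⟩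
        · exact ⟨none, QuotientGroup.eq.mpr (by simpa [cosetRep] using h)⟩
        · exact ⟨some j, QuotientGroup.eq.mpr h⟩
  rw [Subgroup.index, ← Nat.card_eq_of_bijective _ hbij]
  simp

theorem card_quotient_levelGamma0 {p : ℕ} (hp : p.Prime) :
    Nat.card (𝒮ℒ ⧸ (levelGamma0 p).subgroupOf 𝒮ℒ) = p + 1 := by
  have h := Subgroup.relIndex_map_map_of_injective (Gamma0 p) ⊤
    (Matrix.SpecialLinearGroup.mapGL_injective (n := Fin 2) (R := ℤ) (S := ℝ))
  rw [Subgroup.relIndex_top_right, index_Gamma0 hp, ← MonoidHom.range_eq_map] at h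
  exact h

/-! ### Growth at infinity -/

theorem slash_T_zpow_apply (k n : ℤ) (f : ℍ → ℂ) (τ : ℍ) :
    (f ∣[k] (T ^ n)) τ = f ((n : ℝ) +ᵥ τ) := by
  rw [SL_slash_apply, modular_T_zpow_smul]
  have : denom (T ^ n : SL(2, ℤ)) τ = 1 := by
    rw [ModularGroup.denom_apply, (T_zpow_apply n).2.2.1, (T_zpow_apply n).2.2.2]
    simp
  rw [this, one_zpow, mul_one]

theorem periodic_of_slash_T_zpow {k : ℤ} {n : ℕ} {f : ℍ → ℂ} (h : f ∣[k] (T ^ (n : ℤ)) = f) :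
    Function.Periodic (f ∘ ofComplex) (n : ℝ) := by
  intro w
  by_cases hw : 0 < w.im
  · have hw' : 0 < (w + (n : ℝ)).im := by simpa using hw
    simp only [Function.comp_apply, ofComplex_apply_of_im_pos hw', ofComplex_apply_of_im_pos hw]
    conv_rhs => rw [← h, slash_T_zpow_apply]
    congr 1
    ext
    simp [add_comm]
  · have hw' : (w + (n : ℝ)).im ≤ 0 := by simpa using hw
    simp only [Function.comp_apply, ofComplex_apply_of_im_nonpos hw',
      ofComplex_apply_of_im_nonpos (not_lt.mp hw)]

/-- This makes every translate `f ∣[k] g` of a form on `Γ₀(p)` periodic with period `p`. -/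
theorem mul_T_zpow_mul_inv_mem_Gamma0 (p : ℕ) (g : SL(2, ℤ)) :
    g * T ^ (p : ℤ) * g⁻¹ ∈ Gamma0 p := by
  obtain ⟨t1, t2, t3, t4⟩ := T_zpow_apply p
  obtain ⟨h1, -, h3, -⟩ := SL_inv_apply g
  rw [mem_Gamma0_iff_dvd]
  simp only [SL_mul_apply, t1, t2, t3, t4, h1, h3]
  exact ⟨- (g 1 0) ^ 2, by ring⟩

variable {M : ℕ} {k : ℤ}

theorem CuspSpace.slash_eq (f : CuspSpace M k) {g : SL(2, ℤ)} (hg : g ∈ Gamma0 M) :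
    (f : ℍ → ℂ) ∣[k] g = f :=
  SlashInvariantFormClass.slash_action_eq f _ ⟨g, hg, rfl⟩

theorem CuspSpace.isZeroAtImInfty_slash [NeZero M] (f : CuspSpace M k) (g : SL(2, ℤ)) :
    IsZeroAtImInfty ((f : ℍ → ℂ) ∣[k] g) := by
  have hc : IsCusp (Matrix.SpecialLinearGroup.mapGL ℝ g • OnePoint.infty) (levelGamma0 M) := by
    rw [Subgroup.IsArithmetic.isCusp_iff_isCusp_SL2Z]
    exact isCusp_SL2Z_iff'.mpr ⟨g, rfl⟩
  exact CuspFormClass.zero_at_cusps f hc _ rfl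

theorem CuspSpace.slash_slash_T_zpow (f : CuspSpace M k) (g : SL(2, ℤ)) :
    ((f : ℍ → ℂ) ∣[k] g) ∣[k] (T ^ (M : ℤ)) = (f : ℍ → ℂ) ∣[k] g := by
  rw [← SlashAction.slash_mul]
  have h := f.slash_eq (mul_T_zpow_mul_inv_mem_Gamma0 M g)
  conv_rhs => rw [← h, ← SlashAction.slash_mul]
  simp

theorem CuspSpace.slash_isBigO [NeZero M] (f : CuspSpace M k) (g : SL(2, ℤ)) :
    ((f : ℍ → ℂ) ∣[k] g) =O[atImInfty] fun τ => Real.exp (-2 * Real.pi * τ.im / M) := by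
  have h0 := f.isZeroAtImInfty_slash g
  refine h0.exp_decay_atImInfty (h := (M : ℝ)) (by exact_mod_cast Nat.pos_of_ne_zero (NeZero.ne M))
    (periodic_of_slash_T_zpow (f.slash_slash_T_zpow g)) ?_ h0.isBoundedAtImInfty
  exact (CuspFormClass.holo f).slash k _

/-- Dividing by the discriminant lowers the weight by 12 and the order at infinity by one, until the
weight is negative. -/
theorem levelOne_eq_zero_of_isBigO {K : ℤ} (g : ModularForm 𝒮ℒ K) (m : ℕ) (hK : K < 12 * m)
    (hg : (g : ℍ → ℂ) =O[atImInfty] fun τ => Real.exp (-2 * Real.pi * m * τ.im)) : g = 0 := by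
  induction m generalizing K with
  | zero =>
    ext τ
    exact congrFun (ModularFormClass.levelOne_neg_weight_eq_zero (by simpa using hK) g) τ
  | succ m ih =>
    have hzero : IsZeroAtImInfty (g : ℍ → ℂ) := by
      refine hg.trans_tendsto ?_
      have : Tendsto (fun τ : ℍ => -2 * Real.pi * ((m + 1 : ℕ) : ℝ) * τ.im) atImInfty atBot := by
        refine Tendsto.const_mul_atTop_of_neg ?_ tendsto_comap
        have := Real.pi_pos
        push_cast
        nlinarith
      exact Real.tendsto_exp_atBot.comp this
    have h0 : (qExpansion 1 g).coeff 0 = 0 := by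
      rw [qExpansion_coeff_zero one_pos
        (ModularFormClass.analyticAt_cuspFunction_zero g one_pos
          one_mem_strictPeriods_SL)
        (SlashInvariantFormClass.periodic_comp_ofComplex g
          one_mem_strictPeriods_SL)]
      exact hzero.valueAtInfty_eq_zero
    have hd := ih (CuspForm.discriminantEquiv (toCuspForm g h0)) (by push_cast at hK; linarith) ?_
    · rw [LinearEquiv.map_eq_zero_iff] at hd
      ext τ
      exact DFunLike.congr_fun hd τ
    · have h1 := hg.mul (exp_isBigO_discriminant.inv_rev (.of_forall fun τ h =>
        absurd h (Real.exp_pos _).ne'))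
      refine (h1.congr_left fun τ => ?_).congr_right fun τ => ?_
      · rw [CuspForm.discriminantEquiv_apply, div_eq_mul_inv]
        rfl
      · rw [← Real.exp_neg, ← Real.exp_add]
        congr 1
        push_cast
        ring

/-- A cusp form on `Γ₀(p)` with a zero of high order at infinity vanishes. -/
theorem CuspSpace.eq_zero_of_isBigO {p : ℕ} (hp : p.Prime) {k : ℤ} (f : CuspSpace p k) (B : ℕ)
    (hB : k * (p + 1) < 12 * (B + 1))
    (hf : (f : ℍ → ℂ) =O[atImInfty] fun τ => Real.exp (-2 * Real.pi * B * τ.im)) : f = 0 := by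
  have := NeZero.mk hp.ne_zero
  have hcard := card_quotient_levelGamma0 hp
  -- The norm is the product of the `p + 1` translates of `f`, of weight `k (p + 1)`. The trivial
  -- coset contributes order `B` at infinity and each of the other `p` contributes at least `1 / p`,
  -- for a total of `B + 1`.
  suffices h : ModularForm.norm 𝒮ℒ f = 0 from
    DFunLike.coe_injective ((ModularForm.norm_eq_zero_iff 𝒮ℒ f).mp h)
  refine levelOne_eq_zero_of_isBigO _ (B + 1) (by rw [hcard]; push_cast; exact hB) ?_
  rw [ModularForm.coe_norm]
  let := Fintype.ofFinite (𝒮ℒ ⧸ (levelGamma0 p).subgroupOf 𝒮ℒ)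
  classical
  let q₀ : 𝒮ℒ ⧸ (levelGamma0 p).subgroupOf 𝒮ℒ := ⟦1⟧
  have h1 : SlashInvariantForm.quotientFunc f q₀ =O[atImInfty]
      fun τ => Real.exp (-2 * Real.pi * B * τ.im) := by
    simpa [q₀] using hf
  have h2 : ∀ q : 𝒮ℒ ⧸ (levelGamma0 p).subgroupOf 𝒮ℒ,
      SlashInvariantForm.quotientFunc f q =O[atImInfty]
        fun τ => Real.exp (-2 * Real.pi * τ.im / p) := by
    intro q
    induction q using Quotient.inductionOn with
    | h r =>
      obtain ⟨r, g, rfl⟩ := r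
      rw [SlashInvariantForm.quotientFunc_mk]
      have := f.slash_isBigO g⁻¹
      rwa [SL_slash, map_inv] at this
  have h3 := h1.mul (IsBigO.finsetProd (s := Finset.univ.erase q₀) fun q _ => h2 q)
  refine (h3.congr_left fun τ => ?_).congr_right fun τ => ?_
  · rw [Finset.prod_apply]
    exact Finset.mul_prod_erase Finset.univ
      (fun q => SlashInvariantForm.quotientFunc f q τ) (Finset.mem_univ q₀)
  · rw [Finset.prod_const, Finset.card_erase_of_mem (Finset.mem_univ _), Finset.card_univ,
      ← Nat.card_eq_fintype_card, hcard, add_tsub_cancel_right, ← Real.exp_nat_mul, ← Real.exp_add]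
    congr 1
    have : (p : ℝ) ≠ 0 := by exact_mod_cast hp.ne_zero
    field_simp
    push_cast
    ring

end UpperBound

end Ghost
end

noncomputable section
namespace Ghost

/-! ### Bounds for the dimension of `S_k(Γ₀(p))` -/

section Dimension

open UpperHalfPlane ModularForm ModularGroup Asymptotics Filter
open CongruenceSubgroup (Gamma0 Gamma0_mem)
open scoped Manifold Topology

theorem one_mem_strictPeriods_levelGamma0 (M : ℕ) : (1 : ℝ) ∈ (levelGamma0 M).strictPeriods := by
  have hT : T ∈ Gamma0 M := mem_Gamma0_iff_dvd.mpr (by simp [T])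
  rw [levelGamma0, Subgroup.strictPeriods_eq_zmultiples_one_of_T_mem hT]
  exact AddSubgroup.mem_zmultiples 1

theorem norm_qParam (τ : ℍ) :
    ‖Function.Periodic.qParam 1 τ‖ = Real.exp (-2 * Real.pi * τ.im) := by
  simp [Function.Periodic.qParam, Complex.norm_exp]

theorem isBigO_of_coeff_eq_zero {F : ℂ → ℂ} {P : FormalMultilinearSeries ℂ ℂ ℂ}
    (hP : HasFPowerSeriesAt F P 0) (B : ℕ) (h : ∀ n < B, P.coeff n = 0) :
    F =O[𝓝 0] fun q => ‖q‖ ^ B := by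
  refine (hP.isBigO_sub_partialSum_pow B).congr_left fun q => ?_
  rw [FormalMultilinearSeries.partialSum, Finset.sum_eq_zero, sub_zero, zero_add]
  intro n hn
  rw [FormalMultilinearSeries.apply_eq_pow_smul_coeff, h n (Finset.mem_range.mp hn), smul_zero]

theorem CuspSpace.isBigO_of_coeff_eq_zero {M : ℕ} [NeZero M] {k : ℤ} (f : CuspSpace M k) (B : ℕ)
    (h : ∀ n < B, (qExpansion 1 f).coeff n = 0) :
    (f : ℍ → ℂ) =O[atImInfty] fun τ => Real.exp (-2 * Real.pi * B * τ.im) := by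
  have hΓ := one_mem_strictPeriods_levelGamma0 M
  have han := ModularFormClass.analyticAt_cuspFunction_zero f one_pos hΓ
  have : Fact (IsCusp OnePoint.infty (levelGamma0 M)) :=
    ⟨(levelGamma0 M).isCusp_of_mem_strictPeriods one_pos hΓ⟩
  have hps := hasFPowerSeries_cuspFunction f one_pos han
    (c := fun n => (qExpansion 1 f).coeff n)
    (fun τ => ModularForm.hasSum_qExpansion f one_pos hΓ τ)
  have hO := Ghost.isBigO_of_coeff_eq_zero hps.hasFPowerSeriesAt B fun n hn => by
    rw [qExpansionFormalMultilinearSeries_coeff, h n hn]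
  have h1 := hO.comp_tendsto (qParam_tendsto_atImInfty one_pos)
  refine (h1.congr_left fun τ => ?_).congr_right fun τ => ?_
  · exact SlashInvariantFormClass.eq_cuspFunction f τ hΓ one_ne_zero
  · simp only [Function.comp_apply, norm_qParam]
    rw [← Real.exp_nat_mul]
    congr 1
    ring

/-- The coefficients `a₁, …, a_n` of a cusp form. -/
def CuspSpace.coeffs (M : ℕ) (k : ℤ) (n : ℕ) : CuspSpace M k →ₗ[ℂ] (Fin n → ℂ) where
  toFun f i := (qExpansion 1 f).coeff (i + 1)
  map_add' f g := by
    ext i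
    rw [FunLike.coe_add, ModularForm.qExpansion_add one_pos (one_mem_strictPeriods_levelGamma0 M) f g]
    simp
  map_smul' c f := by
    ext i
    rw [FunLike.coe_smul, ModularForm.qExpansion_smul one_pos (one_mem_strictPeriods_levelGamma0 M) c f]
    simp

/-- The coefficient `a₀` of a cusp form is zero, so killing `a₁, …, a_n` gives order `n + 1` at
infinity; the cusp `0` supplies one more, whence `n + 2`. -/
theorem CuspSpace.coeffs_injective {p : ℕ} (hp : p.Prime) {k : ℤ} (n : ℕ)
    (hn : k * (p + 1) < 12 * (n + 2)) : Function.Injective (CuspSpace.coeffs p k n) := by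
  have := NeZero.mk hp.ne_zero
  refine (injective_iff_map_eq_zero _).mpr fun f hf => ?_
  refine f.eq_zero_of_isBigO hp (n + 1) (by push_cast; linarith) ?_
  refine f.isBigO_of_coeff_eq_zero (n + 1) fun m hm => ?_
  rcases m with _ | m
  · exact CuspFormClass.qExpansion_coeff_zero f one_pos (one_mem_strictPeriods_levelGamma0 p)
  · exact congrFun hf ⟨m, by omega⟩

theorem finrank_cuspSpace_le {p : ℕ} (hp : p.Prime) {k : ℤ} (n : ℕ)
    (hn : k * (p + 1) < 12 * (n + 2)) : Module.finrank ℂ (CuspSpace p k) ≤ n := by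
  have := LinearMap.finrank_le_finrank_of_injective (CuspSpace.coeffs_injective hp n hn)
  simpa using this

theorem finiteDimensional_cuspSpace {p : ℕ} (hp : p.Prime) (k : ℤ) :
    FiniteDimensional ℂ (CuspSpace p k) := by
  refine FiniteDimensional.of_injective _
    (CuspSpace.coeffs_injective hp (k * (p + 1)).toNat ?_)
  omega

/-! ### Forms from their behaviour at the two cusps -/

theorem S_inv_eq : S⁻¹ = -1 * S := by
  rw [neg_one_mul]
  ext i j
  obtain ⟨h1, h2, h3, h4⟩ := SL_inv_apply S
  obtain ⟨s1, s2, s3, s4⟩ := S_apply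
  fin_cases i <;> fin_cases j <;> simp [h1, h2, h3, h4, s1, s2, s3, s4]

/-- There are only two cusps: up to translation, conditions at all cusps reduce to `f` and `f ∣[k]
S`. -/
theorem exists_slash_eq {p : ℕ} (hp : p.Prime) {k : ℤ} {f : ℍ → ℂ}
    (hf : ∀ g ∈ Gamma0 p, f ∣[k] g = f) (g : SL(2, ℤ)) :
    f ∣[k] g = f ∨ ∃ n : ℤ, f ∣[k] g = (f ∣[k] S) ∣[k] (T ^ n) := by
  rcases exists_coset_rep hp g⁻¹ with h | ⟨j, h⟩
  · exact .inl (hf g (inv_mem_iff.mp h))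
  · refine .inr ⟨-j, ?_⟩
    have hneg : (-1 : SL(2, ℤ)) ∈ Gamma0 p := mem_Gamma0_iff_dvd.mpr (by simp)
    have h1 := hf _ (inv_mem h)
    rw [mul_inv_rev, inv_inv, inv_inv] at h1
    have hS : f ∣[k] S⁻¹ = f ∣[k] S := by rw [S_inv_eq, SlashAction.slash_mul, hf _ hneg]
    have hg : g = (g * (T ^ (j : ℤ) * S)) * (S⁻¹ * T ^ (-(j : ℤ))) := by group
    rw [hg, SlashAction.slash_mul, h1, SlashAction.slash_mul, hS]

theorem T_zpow_mapGL_one_zero (n : ℤ) :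
    (Matrix.SpecialLinearGroup.mapGL ℝ (T ^ n)) 1 0 = (0 : ℝ) := by
  have := (T_zpow_apply n).2.2.1
  rw [Matrix.SpecialLinearGroup.mapGL_coe_matrix]
  exact (congrArg (Int.cast : ℤ → ℝ) this).trans Int.cast_zero

/-- A cusp form on `Γ₀(p)` from its behaviour at the cusps `∞` and `0`. -/
def CuspSpace.mk' {p : ℕ} (hp : p.Prime) {k : ℤ} (f : ℍ → ℂ) (hd : MDiff f)
    (hf : ∀ g ∈ Gamma0 p, f ∣[k] g = f) (h1 : IsZeroAtImInfty f)
    (h2 : IsZeroAtImInfty (f ∣[k] S)) : CuspSpace p k where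
  toFun := f
  slash_action_eq' := by
    rintro _ ⟨g, hg, rfl⟩
    exact hf g hg
  holo' := hd
  zero_at_cusps' {c} hc := by
    have := NeZero.mk hp.ne_zero
    rw [Subgroup.IsArithmetic.isCusp_iff_isCusp_SL2Z] at hc
    rw [OnePoint.isZeroAt_iff_forall_SL2Z hc]
    intro g _
    rcases exists_slash_eq hp hf g with h | ⟨n, h⟩
    · exact (congrArg _ h).mpr h1
    · exact (congrArg _ h).mpr (h2.slash k (T_zpow_mapGL_one_zero n))

/-- The space of modular forms of weight `k` on `Γ₀(M)`. -/
abbrev ModSpace (M : ℕ) (k : ℤ) : Type := ModularForm (levelGamma0 M) k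

/-- A modular form on `Γ₀(p)` from its behaviour at the cusps `∞` and `0`. -/
def ModSpace.mk' {p : ℕ} (hp : p.Prime) {k : ℤ} (f : ℍ → ℂ) (hd : MDiff f)
    (hf : ∀ g ∈ Gamma0 p, f ∣[k] g = f) (h1 : IsBoundedAtImInfty f)
    (h2 : IsBoundedAtImInfty (f ∣[k] S)) : ModSpace p k where
  toFun := f
  slash_action_eq' := by
    rintro _ ⟨g, hg, rfl⟩
    exact hf g hg
  holo' := hd
  bdd_at_cusps' {c} hc := by
    have := NeZero.mk hp.ne_zero
    rw [Subgroup.IsArithmetic.isCusp_iff_isCusp_SL2Z] at hc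
    rw [OnePoint.isBoundedAt_iff_forall_SL2Z hc]
    intro g _
    rcases exists_slash_eq hp hf g with h | ⟨n, h⟩
    · exact (congrArg _ h).mpr h1
    · exact (congrArg _ h).mpr (h2.slash k (T_zpow_mapGL_one_zero n))

theorem ModSpace.slash_eq {M : ℕ} {k : ℤ} (f : ModSpace M k) {g : SL(2, ℤ)} (hg : g ∈ Gamma0 M) :
    (f : ℍ → ℂ) ∣[k] g = f :=
  SlashInvariantFormClass.slash_action_eq f _ ⟨g, hg, rfl⟩

theorem ModSpace.tendsto_valueAtInfty {M : ℕ} [NeZero M] {k : ℤ} (f : ModSpace M k)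
    (g : SL(2, ℤ)) : Tendsto ((f : ℍ → ℂ) ∣[k] g) atImInfty
      (𝓝 (valueAtInfty ((f : ℍ → ℂ) ∣[k] g))) := by
  have hb : IsBoundedAtImInfty ((f : ℍ → ℂ) ∣[k] g) := by
    have hc : IsCusp (Matrix.SpecialLinearGroup.mapGL ℝ g • OnePoint.infty) (levelGamma0 M) := by
      rw [Subgroup.IsArithmetic.isCusp_iff_isCusp_SL2Z]
      exact isCusp_SL2Z_iff'.mpr ⟨g, rfl⟩
    exact ModularFormClass.bdd_at_cusps f hc _ rfl
  have hT : ((f : ℍ → ℂ) ∣[k] g) ∣[k] (T ^ (M : ℤ)) = (f : ℍ → ℂ) ∣[k] g := by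
    rw [← SlashAction.slash_mul]
    have h := f.slash_eq (mul_T_zpow_mul_inv_mem_Gamma0 M g)
    conv_rhs => rw [← h, ← SlashAction.slash_mul]
    simp
  have hM : (0 : ℝ) < M := by exact_mod_cast Nat.pos_of_ne_zero (NeZero.ne M)
  have hper := periodic_of_slash_T_zpow hT
  have hd : MDiff ((f : ℍ → ℂ) ∣[k] g) := (ModularFormClass.holo f).slash k _
  have han := analyticAt_cuspFunction_zero hM hper hd hb
  rw [← cuspFunction_apply_zero hM han hper]
  exact (han.continuousAt.tendsto.comp (qParam_tendsto_atImInfty hM)).congr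
    fun τ => eq_cuspFunction τ hM.ne' hper

theorem ModSpace.tendsto_valueAtInfty_self {M : ℕ} [NeZero M] {k : ℤ} (f : ModSpace M k) :
    Tendsto f atImInfty (𝓝 (valueAtInfty f)) := by
  simpa using f.tendsto_valueAtInfty 1

/-- The values of a modular form on `Γ₀(p)` at the two cusps. -/
def ModSpace.cuspValues (M : ℕ) [NeZero M] (k : ℤ) : ModSpace M k →ₗ[ℂ] ℂ × ℂ where
  toFun f := (valueAtInfty f, valueAtInfty ((f : ℍ → ℂ) ∣[k] S))
  map_add' f g := by
    refine Prod.ext ?_ ?_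
    · exact (f.tendsto_valueAtInfty_self.add g.tendsto_valueAtInfty_self).limUnder_eq
    · have := (f.tendsto_valueAtInfty S).add (g.tendsto_valueAtInfty S)
      rw [FunLike.coe_add, SlashAction.add_slash]
      exact this.limUnder_eq
  map_smul' c f := by
    refine Prod.ext ?_ ?_
    · exact (f.tendsto_valueAtInfty_self.const_smul c).limUnder_eq
    · have := (f.tendsto_valueAtInfty S).const_smul c
      rw [FunLike.coe_smul, SL_smul_slash]
      exact this.limUnder_eq

theorem ModSpace.cuspValues_eq {M : ℕ} [NeZero M] {k : ℤ} {f : ModSpace M k} {a b : ℂ}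
    (h1 : Tendsto f atImInfty (𝓝 a)) (h2 : Tendsto ((f : ℍ → ℂ) ∣[k] S) atImInfty (𝓝 b)) :
    ModSpace.cuspValues M k f = (a, b) :=
  Prod.ext h1.limUnder_eq h2.limUnder_eq

/-- A modular form on `Γ₀(p)` vanishing at both cusps is a cusp form. -/
def ModSpace.toCusp {p : ℕ} (hp : p.Prime) [NeZero p] {k : ℤ} (f : ModSpace p k)
    (h : ModSpace.cuspValues p k f = 0) : CuspSpace p k :=
  CuspSpace.mk' hp f (ModularFormClass.holo f) (fun _ hg => f.slash_eq hg)
    (by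
      have := f.tendsto_valueAtInfty_self
      rwa [show valueAtInfty f = 0 from congrArg Prod.fst h] at this)
    (by
      have := f.tendsto_valueAtInfty S
      rwa [show valueAtInfty ((f : ℍ → ℂ) ∣[k] S) = 0 from congrArg Prod.snd h] at this)

theorem ker_cuspValues {p : ℕ} (hp : p.Prime) [NeZero p] (k : ℤ) :
    LinearMap.ker (ModSpace.cuspValues p k) =
      LinearMap.range (CuspForm.toModularFormₗ (Γ := levelGamma0 p) (k := k)) := by
  ext f
  rw [LinearMap.mem_ker, LinearMap.mem_range]
  constructor
  · intro h
    exact ⟨f.toCusp hp h, rfl⟩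
  · rintro ⟨g, rfl⟩
    have h1 := CuspSpace.isZeroAtImInfty_slash g 1
    have h2 := CuspSpace.isZeroAtImInfty_slash g S
    rw [SlashAction.slash_one] at h1
    exact ModSpace.cuspValues_eq h1 h2

theorem finrank_ker_cuspValues {p : ℕ} (hp : p.Prime) [NeZero p] (k : ℤ) :
    Module.finrank ℂ (LinearMap.ker (ModSpace.cuspValues p k)) =
      Module.finrank ℂ (CuspSpace p k) := by
  rw [ker_cuspValues hp]
  exact LinearMap.finrank_range_of_inj CuspForm.toModularFormₗ_injective

theorem finiteDimensional_modSpace {p : ℕ} (hp : p.Prime) (k : ℤ) :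
    FiniteDimensional ℂ (ModSpace p k) := by
  have := NeZero.mk hp.ne_zero
  have := finiteDimensional_cuspSpace hp k
  have h1 : FiniteDimensional ℂ (LinearMap.ker (ModSpace.cuspValues p k)) := by
    rw [ker_cuspValues hp]
    infer_instance
  have h2 : FiniteDimensional ℂ (ModSpace p k ⧸ LinearMap.ker (ModSpace.cuspValues p k)) :=
    Module.Finite.equiv (ModSpace.cuspValues p k).quotKerEquivRange.symm
  exact Module.Finite.of_submodule_quotient (LinearMap.ker (ModSpace.cuspValues p k))

theorem finrank_modSpace_of_surjective {p : ℕ} (hp : p.Prime) [NeZero p] (k : ℤ)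
    (h : Function.Surjective (ModSpace.cuspValues p k)) :
    Module.finrank ℂ (ModSpace p k) = 2 + Module.finrank ℂ (CuspSpace p k) := by
  have := finiteDimensional_modSpace hp k
  rw [← LinearMap.finrank_range_add_finrank_ker (ModSpace.cuspValues p k),
    finrank_ker_cuspValues hp, LinearMap.range_eq_top.mpr h, finrank_top, Module.finrank_prod,
    Module.finrank_self]

/-- Multiplication by a fixed cusp form. -/
def mulCusp {p : ℕ} {k l m : ℤ} (hm : k + l = m) (F : CuspSpace p k) :
    ModSpace p l →ₗ[ℂ] CuspSpace p m where
  toFun g := CuspForm.mcast hm (F.mulModularForm g)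
  map_add' g g' := by
    ext τ
    exact mul_add (F τ) (g τ) (g' τ)
  map_smul' c g := by
    ext τ
    exact mul_left_comm (F τ) c (g τ)

/-- Multiplication by `F` is injective, since a product of nonzero forms is nonzero. This is the
engine of the lower bounds. -/
theorem finrank_modSpace_le {p : ℕ} (hp : p.Prime) {k l m : ℤ} (hm : k + l = m)
    {F : CuspSpace p k} (hF : F ≠ 0) :
    Module.finrank ℂ (ModSpace p l) ≤ Module.finrank ℂ (CuspSpace p m) := by
  have := NeZero.mk hp.ne_zero
  have := finiteDimensional_cuspSpace hp m
  refine LinearMap.finrank_le_finrank_of_injective (f := mulCusp hm F) ?_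
  refine (injective_iff_map_eq_zero _).mpr fun g hg => ?_
  by_contra hne
  refine ModularForm.mul_ne_zero (f := CuspForm.toModularFormₗ F) (g := g)
    ⟨1, one_mem_strictPeriods_levelGamma0 p, one_pos⟩ ?_ hne ?_
  · exact fun h => hF (CuspForm.toModularFormₗ_injective (h.trans (map_zero _).symm))
  · ext τ
    exact DFunLike.congr_fun hg τ

end Dimension

end Ghost
end

noncomputable section
namespace Ghost

/-! ### The operator `f(τ) ↦ f(pτ)` -/

section Scale

open UpperHalfPlane ModularForm ModularGroup Filter
open CongruenceSubgroup (Gamma0 Gamma0_mem)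
open scoped Manifold Topology

variable (p : ℕ) [NeZero p]

theorem natCast_pos_of_neZero : (0 : ℝ) < p := by
  exact_mod_cast Nat.pos_of_ne_zero (NeZero.ne p)

theorem natCast_ne_zero_of_neZero : (p : ℂ) ≠ 0 := by
  exact_mod_cast NeZero.ne p

@[simp] theorem coe_scale (τ : ℍ) : (scale p τ : ℂ) = p * τ := rfl

/-- The point `τ / p` of the upper half plane. -/
def divScale (τ : ℍ) : ℍ :=
  ⟨(τ : ℂ) / p, by
    have h := natCast_pos_of_neZero p
    simpa using div_pos τ.im_pos h⟩

@[simp] theorem coe_divScale (τ : ℍ) : (divScale p τ : ℂ) = τ / p := rfl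

theorem im_scale (τ : ℍ) : (scale p τ).im = p * τ.im := by
  rw [← coe_im, coe_scale]
  simp

theorem im_divScale (τ : ℍ) : (divScale p τ).im = τ.im / p := by
  rw [← coe_im, coe_divScale]
  simp

theorem tendsto_scale_atImInfty : Tendsto (scale p) atImInfty atImInfty := by
  rw [atImInfty, tendsto_comap_iff]
  refine ((tendsto_comap (f := UpperHalfPlane.im)).const_mul_atTop
    (natCast_pos_of_neZero p)).congr fun τ => (im_scale p τ).symm

theorem tendsto_divScale_atImInfty : Tendsto (divScale p) atImInfty atImInfty := by
  rw [atImInfty, tendsto_comap_iff]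
  refine ((tendsto_comap (f := UpperHalfPlane.im)).atTop_div_const
    (natCast_pos_of_neZero p)).congr fun τ => (im_divScale p τ).symm

theorem mdiff_comp_scale {f : ℍ → ℂ} (hf : MDiff f) : MDiff (f ∘ scale p) := by
  rw [UpperHalfPlane.mdifferentiable_iff] at hf ⊢
  have hm : Set.MapsTo (fun z : ℂ => p * z) {z | 0 < z.im} {z | 0 < z.im} := fun z hz => by
    have hz' : 0 < z.im := hz
    simpa using mul_pos (natCast_pos_of_neZero p) hz'
  refine (hf.comp (differentiableOn_id.const_mul (p : ℂ)) hm).congr fun z hz => ?_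
  simp only [Function.comp_apply]
  congr 1
  ext
  rw [coe_scale, ofComplex_apply_of_im_pos hz, ofComplex_apply_of_im_pos (hm hz)]

variable {p}

/-- The matrix `g'` is the conjugate of `g` by `diag(p, 1)`, integral because `p` divides the lower
left entry. -/
theorem exists_scale_smul {g : SL(2, ℤ)} (hg : g ∈ Gamma0 p) :
    ∃ g' : SL(2, ℤ), (p : ℤ) * g' 1 0 = g 1 0 ∧ (∀ τ, scale p (g • τ) = g' • scale p τ) ∧
      ∀ τ : ℍ, denom g' (scale p τ) = denom g τ := by
  obtain ⟨c, hc⟩ := mem_Gamma0_iff_dvd.mp hg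
  have hdet := g.det_coe
  rw [Matrix.det_fin_two] at hdet
  let g' : SL(2, ℤ) := ⟨!![g 0 0, p * g 0 1; c, g 1 1], by
    rw [Matrix.det_fin_two_of]
    linear_combination hdet + g 0 1 * hc⟩
  have e00 : g' 0 0 = g 0 0 := rfl
  have e01 : g' 0 1 = p * g 0 1 := rfl
  have e10 : g' 1 0 = c := rfl
  have e11 : g' 1 1 = g 1 1 := rfl
  have hden : ∀ τ : ℍ, denom g' (scale p τ) = denom g τ := fun τ => by
    rw [denom_apply, denom_apply, e10, e11, hc, coe_scale]
    push_cast
    ring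
  refine ⟨g', by rw [e10, hc], fun τ => ?_, hden⟩
  ext
  rw [coe_scale, coe_specialLinearGroup_apply, coe_specialLinearGroup_apply, e00, e01, e10, e11,
    hc, coe_scale]
  simp only [algebraMap_int_eq, eq_intCast, Int.cast_mul, Int.cast_natCast, Complex.ofReal_mul,
    Complex.ofReal_intCast, Complex.ofReal_natCast]
  rw [← mul_div_assoc]
  congr 1 <;> ring

theorem slash_comp_scale {g g' : SL(2, ℤ)} (h1 : ∀ τ, scale p (g • τ) = g' • scale p τ)
    (h2 : ∀ τ : ℍ, denom g' (scale p τ) = denom g τ) (f : ℍ → ℂ) (k : ℤ) :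
    (f ∘ scale p) ∣[k] g = (f ∣[k] g') ∘ scale p := by
  ext τ
  rw [Function.comp_apply, SL_slash_apply, SL_slash_apply, h2, Function.comp_apply, h1]

theorem slash_comp_scale_of_slash_eq {f : ℍ → ℂ} {k : ℤ} (hf : ∀ g : SL(2, ℤ), f ∣[k] g = f)
    {g : SL(2, ℤ)} (hg : g ∈ Gamma0 p) : (f ∘ scale p) ∣[k] g = f ∘ scale p := by
  obtain ⟨g', _, h1, h2⟩ := exists_scale_smul hg
  rw [slash_comp_scale h1 h2, hf]

variable (p) in
theorem slash_S_comp_scale (f : ℍ → ℂ) (k : ℤ) (τ : ℍ) :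
    ((f ∘ scale p) ∣[k] S) τ = (p : ℂ) ^ (-k) * (f ∣[k] S) (divScale p τ) := by
  have hp := natCast_ne_zero_of_neZero p
  rw [SL_slash_apply, SL_slash_apply, Function.comp_apply, denom_S, denom_S, coe_divScale,
    mul_left_comm, ← mul_zpow, mul_div_cancel₀ _ hp]
  congr 2
  ext
  rw [coe_scale, modular_S_smul, modular_S_smul]
  have := τ.ne_zero
  simp only [coe_divScale]
  field_simp

end Scale

/-! ### Expansions to first order at `i∞` -/

section FirstOrder

open UpperHalfPlane ModularForm ModularGroup Filter
open Function.Periodic (qParam)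
open scoped Manifold Topology

/-- The function `f` has the expansion `a + b q + o(q)` at `i∞`. -/
def FirstOrder (f : ℍ → ℂ) (a b : ℂ) : Prop :=
  Tendsto (fun τ : ℍ => (f τ - a) / qParam 1 τ) atImInfty (𝓝 b)

theorem qParam_ne_zero' (τ : ℍ) : qParam 1 (τ : ℂ) ≠ 0 := Complex.exp_ne_zero _

namespace FirstOrder

variable {f g : ℍ → ℂ} {a b a' b' : ℂ}

theorem tendsto (h : FirstOrder f a b) : Tendsto f atImInfty (𝓝 a) := by
  have h0 := h.mul (qParam_tendsto_atImInfty one_pos)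
  have h1 := h0.add_const a
  rw [mul_zero, zero_add] at h1
  refine h1.congr fun τ => ?_
  rw [div_mul_cancel₀ _ (qParam_ne_zero' τ), sub_add_cancel]

theorem add (h : FirstOrder f a b) (h' : FirstOrder g a' b') :
    FirstOrder (f + g) (a + a') (b + b') := by
  refine (Tendsto.add h h').congr fun τ => ?_
  rw [Pi.add_apply]
  ring

theorem smul (c : ℂ) (h : FirstOrder f a b) : FirstOrder (c • f) (c * a) (c * b) := by
  refine (Tendsto.const_mul c h).congr fun τ => ?_
  rw [Pi.smul_apply, smul_eq_mul]
  ring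

theorem mul (h : FirstOrder f a b) (h' : FirstOrder g a' b') :
    FirstOrder (f * g) (a * a') (a * b' + b * a') := by
  refine ((h.tendsto.mul h').add (Tendsto.mul_const a' h)).congr fun τ => ?_
  rw [Pi.mul_apply]
  ring

/-- Under `τ ↦ pτ` the parameter `q` becomes `q ^ p`, so nothing is left in degree one. -/
theorem comp_scale (h : FirstOrder f a b) {p : ℕ} [NeZero p] (hp : 2 ≤ p) :
    FirstOrder (f ∘ scale p) a 0 := by
  have h1 := (Tendsto.comp h (tendsto_scale_atImInfty p)).mul
    ((qParam_tendsto_atImInfty one_pos).pow (p - 1))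
  rw [zero_pow (by omega), mul_zero] at h1
  refine h1.congr fun τ => ?_
  have hq : qParam 1 (scale p τ : ℂ) = qParam 1 (τ : ℂ) ^ (p - 1) * qParam 1 (τ : ℂ) := by
    rw [← pow_succ, Nat.sub_add_cancel (by omega), qParam, qParam, ← Complex.exp_nat_mul, coe_scale]
    congr 1
    ring
  have := qParam_ne_zero' τ
  simp only [Function.comp_apply]
  rw [hq]
  field_simp

theorem unique (h : FirstOrder f a b) (h' : FirstOrder f a b') : b = b' :=
  tendsto_nhds_unique h h'

/-- The coefficient `c 1` is the derivative at `0` of the function of `q`, that is, the limit of its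
slopes. -/
theorem of_hasSum {c : ℕ → ℂ} (hper : Function.Periodic (f ∘ ofComplex) ((1 : ℝ) : ℂ))
    (han : AnalyticAt ℂ (cuspFunction 1 f) 0)
    (hs : ∀ τ : ℍ, HasSum (fun m => c m • qParam 1 τ ^ m) (f τ)) : FirstOrder f (c 0) (c 1) := by
  have hP := (hasFPowerSeriesOnBall_cuspFunction one_pos han hs).hasFPowerSeriesAt
  have h0 : cuspFunction 1 f 0 = c 0 := by
    rw [← hP.coeff_zero 1]
    simp
  have hd := hP.hasDerivAt
  rw [hasDerivAt_iff_tendsto_slope] at hd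
  have hq : Tendsto (fun τ : ℍ => qParam 1 (τ : ℂ)) atImInfty (𝓝[≠] 0) :=
    tendsto_nhdsWithin_iff.mpr ⟨qParam_tendsto_atImInfty one_pos, .of_forall qParam_ne_zero'⟩
  have h1 := hd.comp hq
  have h2 : ((FormalMultilinearSeries.ofScalars ℂ c) 1 fun _ => (1 : ℂ)) = c 1 := by simp
  refine (h2 ▸ h1).congr fun τ => ?_
  rw [Function.comp_apply, slope_def_field, sub_zero, h0, eq_cuspFunction τ one_ne_zero hper]

theorem of_levelOne {k : ℤ} (F : ModularForm 𝒮ℒ k) :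
    FirstOrder F ((qExpansion 1 F).coeff 0) ((qExpansion 1 F).coeff 1) := by
  have h1 : (1 : ℝ) ∈ (𝒮ℒ).strictPeriods := by simp
  exact of_hasSum (SlashInvariantFormClass.periodic_comp_ofComplex F h1)
    (ModularFormClass.analyticAt_cuspFunction_zero F one_pos h1)
    (c := fun n => (qExpansion 1 F).coeff n) fun τ => ModularForm.hasSum_qExpansion F one_pos h1 τ

/-- `E2` is not modular, but its correction term for `T` is zero, and period one is all that is
needed. -/
theorem E2_firstOrder : FirstOrder EisensteinSeries.E2 1 (-24) := by
  have hT : EisensteinSeries.E2 ∣[(2 : ℤ)] (T ^ ((1 : ℕ) : ℤ)) = EisensteinSeries.E2 := by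
    rw [Nat.cast_one, zpow_one, EisensteinSeries.E2_slash_action, EisensteinSeries.D2_T, smul_zero,
      sub_zero]
  have hper := periodic_of_slash_T_zpow hT
  rw [Nat.cast_one] at hper
  have han := analyticAt_cuspFunction_zero one_pos hper E2_mdifferentiable
    EisensteinSeries.isBoundedAtImInfty_E2
  have := of_hasSum hper han (c := fun m => if m = 0 then 1 else -24 * ArithmeticFunction.sigma 1 m)
    fun τ => by
      simpa only [qParam, Complex.ofReal_one, div_one] using
        EisensteinSeries.hasSum_qExpansion_E2 (z := τ)
  simpa using this

end FirstOrder

end FirstOrder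

/-! ### Eisenstein series on `Γ₀(p)` -/

section Forms

open UpperHalfPlane ModularForm ModularGroup Filter
open CongruenceSubgroup (Gamma0 Gamma0_mem)
open EisensteinSeries (E2 D2)
open scoped Manifold Topology

theorem levelOne_slash_eq {k : ℤ} (f : ModularForm 𝒮ℒ k) (g : SL(2, ℤ)) :
    (f : ℍ → ℂ) ∣[k] g = f :=
  SlashInvariantFormClass.slash_action_eq f _ ⟨g, rfl⟩

variable {p : ℕ} [NeZero p]

theorem ModSpace.exists_of_tendsto (hp : p.Prime) {k : ℤ} {f : ℍ → ℂ} (hd : MDiff f)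
    (hf : ∀ g ∈ Gamma0 p, f ∣[k] g = f) {a b : ℂ} (h1 : Tendsto f atImInfty (𝓝 a))
    (h2 : Tendsto (f ∣[k] S) atImInfty (𝓝 b)) :
    ∃ F : ModSpace p k, (F : ℍ → ℂ) = f ∧ ModSpace.cuspValues p k F = (a, b) :=
  ⟨ModSpace.mk' hp f hd hf (h1.isBigO_one ℝ) (h2.isBigO_one ℝ), rfl,
    ModSpace.cuspValues_eq h1 h2⟩

theorem ModSpace.exists_levelOne (hp : p.Prime) {k : ℤ} (f : ModularForm 𝒮ℒ k) {a : ℂ}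
    (h : Tendsto f atImInfty (𝓝 a)) :
    ∃ F : ModSpace p k, (F : ℍ → ℂ) = f ∧ ModSpace.cuspValues p k F = (a, a) :=
  exists_of_tendsto hp (ModularFormClass.holo f) (fun g _ => levelOne_slash_eq f g) h
    (by rwa [levelOne_slash_eq])

theorem ModSpace.exists_comp_scale (hp : p.Prime) {k : ℤ} (f : ModularForm 𝒮ℒ k) {a : ℂ}
    (h : Tendsto f atImInfty (𝓝 a)) :
    ∃ F : ModSpace p k, (F : ℍ → ℂ) = f ∘ scale p ∧
      ModSpace.cuspValues p k F = (a, (p : ℂ) ^ (-k) * a) := by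
  refine exists_of_tendsto hp (mdiff_comp_scale p (ModularFormClass.holo f))
    (fun g hg => slash_comp_scale_of_slash_eq (levelOne_slash_eq f) hg)
    (h.comp (tendsto_scale_atImInfty p)) ?_
  refine ((h.comp (tendsto_divScale_atImInfty p)).const_mul _).congr fun τ => ?_
  rw [slash_S_comp_scale, levelOne_slash_eq, Function.comp_apply]

variable (p) in
/-- The Eisenstein series `p E₂(pτ) - E₂(τ)` of weight `2` on `Γ₀(p)`. -/
def eisTwo : ℍ → ℂ := (p : ℂ) • (E2 ∘ scale p) + (-1 : ℂ) • E2

theorem eisTwo_firstOrder (hp : 2 ≤ p) : FirstOrder (eisTwo p) (p - 1) 24 := by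
  have := ((FirstOrder.E2_firstOrder.comp_scale hp).smul (p : ℂ)).add
    (FirstOrder.E2_firstOrder.smul (-1 : ℂ))
  rw [eisTwo]
  convert this using 1 <;> ring

/-- The non-modular corrections of `p E₂(pτ)` and `E₂(τ)` are equal and cancel in the difference. -/
theorem eisTwo_slash {g : SL(2, ℤ)} (hg : g ∈ Gamma0 p) : eisTwo p ∣[(2 : ℤ)] g = eisTwo p := by
  obtain ⟨g', hc, h1, h2⟩ := exists_scale_smul hg
  have hD (τ : ℍ) : (p : ℂ) * D2 g' (scale p τ) = D2 g τ := by
    rw [D2, D2, h2, ← hc]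
    push_cast
    ring
  rw [eisTwo, SlashAction.add_slash, SL_smul_slash, SL_smul_slash, slash_comp_scale h1 h2,
    EisensteinSeries.E2_slash_action, EisensteinSeries.E2_slash_action]
  ext τ
  simp only [Pi.add_apply, Pi.smul_apply, Function.comp_apply, Pi.sub_apply, smul_eq_mul, ← hD]
  ring

theorem eisTwo_slash_S (τ : ℍ) :
    (eisTwo p ∣[(2 : ℤ)] S) τ = (p : ℂ)⁻¹ * E2 (divScale p τ) - E2 τ := by
  have hp := natCast_ne_zero_of_neZero p
  have hτ := τ.ne_zero
  rw [eisTwo, SlashAction.add_slash, SL_smul_slash, SL_smul_slash]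
  simp only [Pi.add_apply, Pi.smul_apply, smul_eq_mul, slash_S_comp_scale,
    EisensteinSeries.E2_slash_action, Pi.sub_apply, EisensteinSeries.D2_S, coe_divScale]
  rw [show (p : ℂ) ^ (-2 : ℤ) = ((p : ℂ) ^ 2)⁻¹ by rw [zpow_neg]; rfl]
  field_simp
  ring

theorem ModSpace.exists_eisTwo (hp : p.Prime) :
    ∃ F : ModSpace p 2, (F : ℍ → ℂ) = eisTwo p ∧
      ModSpace.cuspValues p 2 F = ((p : ℂ) - 1, (p : ℂ)⁻¹ - 1) := by
  have hE := FirstOrder.E2_firstOrder.tendsto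
  refine exists_of_tendsto hp ?_ (fun g hg => eisTwo_slash hg)
    (eisTwo_firstOrder hp.two_le).tendsto ?_
  · exact ((mdiff_comp_scale p E2_mdifferentiable).const_smul (p : ℂ)).add
      (E2_mdifferentiable.const_smul (-1 : ℂ))
  · have := ((hE.comp (tendsto_divScale_atImInfty p)).const_mul (p : ℂ)⁻¹).sub hE
    rw [mul_one] at this
    exact this.congr fun τ => (eisTwo_slash_S τ).symm

theorem ModSpace.cuspValues_mul {k l : ℤ} (f : ModSpace p k) (g : ModSpace p l) :
    ModSpace.cuspValues p (k + l) (f.mul g) =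
      ModSpace.cuspValues p k f * ModSpace.cuspValues p l g := by
  refine ModSpace.cuspValues_eq (f.tendsto_valueAtInfty_self.mul g.tendsto_valueAtInfty_self) ?_
  have := (f.tendsto_valueAtInfty S).mul (g.tendsto_valueAtInfty S)
  rw [show ((f.mul g : ModSpace p (k + l)) : ℍ → ℂ) = f * g from rfl, mul_slash_SL2]
  exact this

theorem exists_cuspForm_five : ∃ F : CuspSpace 5 4, F ≠ 0 := by
  have h5 : Nat.Prime 5 := by norm_num
  have hE := FirstOrder.of_levelOne E₄
  rw [EisensteinSeries.E_qExpansion_coeff_zero _ (by decide), E₄_qExpansion_coeff_one] at hE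
  obtain ⟨φ, hφ, vφ⟩ := ModSpace.exists_eisTwo (p := 5) h5
  obtain ⟨A, hA, vA⟩ := ModSpace.exists_levelOne (p := 5) h5 E₄ hE.tendsto
  obtain ⟨B, hB, vB⟩ := ModSpace.exists_comp_scale (p := 5) h5 E₄ hE.tendsto
  obtain ⟨P, hP, vP⟩ : ∃ P : ModSpace 5 4, (P : ℍ → ℂ) = φ * φ ∧ ModSpace.cuspValues 5 4 P =
      ModSpace.cuspValues 5 2 φ * ModSpace.cuspValues 5 2 φ :=
    ⟨φ.mul φ, rfl, ModSpace.cuspValues_mul φ φ⟩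
  -- The values at the cusps `∞` and `0` are `(16, 16/25)` for `P`, `(1, 1)` for `A` and `(1,
  -- 1/625)` for `B`; this combination kills both.
  let G : ModSpace 5 4 := (26 / 16 : ℂ) • P + ((-1 : ℂ) • A + (-25 : ℂ) • B)
  have hG : ModSpace.cuspValues 5 4 G = 0 := by
    rw [map_add, map_add, map_smul, map_smul, map_smul, vP, vφ, vA, vB]
    ext <;> norm_num
  -- The coefficient of `q` is `(26/16) · (2 · 4 · 24) - 240 = 72`; being nonzero, it shows `G ≠ 0`.
  have hF : FirstOrder G 0 72 := by
    have h1 := eisTwo_firstOrder (p := 5) (by norm_num)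
    have := ((h1.mul h1).smul (26 / 16)).add ((hE.smul (-1)).add
      ((hE.comp_scale (p := 5) (by norm_num)).smul (-25)))
    rw [← hB, ← hA, ← hφ, ← hP] at this
    change FirstOrder ((26 / 16 : ℂ) • ⇑P + ((-1 : ℂ) • ⇑A + (-25 : ℂ) • ⇑B)) 0 72
    convert this using 1 <;> norm_num
  refine ⟨G.toCusp h5 hG, fun h => ?_⟩
  have h0 : (G : ℍ → ℂ) = 0 := funext fun τ => DFunLike.congr_fun h τ
  rw [h0] at hF
  have := hF.unique (b' := 0) (by simp [FirstOrder])
  norm_num at this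

theorem exists_cuspForm_three : ∃ F : CuspSpace 3 6, F ≠ 0 := by
  have h3 : Nat.Prime 3 := by norm_num
  have hE := FirstOrder.of_levelOne E₆
  rw [EisensteinSeries.E_qExpansion_coeff_zero _ (by decide), E₆_qExpansion_coeff_one] at hE
  obtain ⟨φ, hφ, vφ⟩ := ModSpace.exists_eisTwo (p := 3) h3
  obtain ⟨A, hA, vA⟩ := ModSpace.exists_levelOne (p := 3) h3 E₆ hE.tendsto
  obtain ⟨B, hB, vB⟩ := ModSpace.exists_comp_scale (p := 3) h3 E₆ hE.tendsto
  obtain ⟨P, hP, vP⟩ : ∃ P : ModSpace 3 6, (P : ℍ → ℂ) = φ * φ * φ ∧ ModSpace.cuspValues 3 6 P =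
      ModSpace.cuspValues 3 2 φ * ModSpace.cuspValues 3 2 φ * ModSpace.cuspValues 3 2 φ :=
    ⟨(φ.mul φ).mul φ, rfl, by
      rw [← ModSpace.cuspValues_mul φ φ]
      exact ModSpace.cuspValues_mul (φ.mul φ) φ⟩
  -- The values at the two cusps are `(8, -8/27)` for `P`, `(1, 1)` for `A` and `(1, 1/729)` for
  -- `B`.
  let G : ModSpace 3 6 := (26 / 8 : ℂ) • P + (A + (-27 : ℂ) • B)
  have hG : ModSpace.cuspValues 3 6 G = 0 := by
    rw [map_add, map_add, map_smul, map_smul, vP, vφ, vA, vB]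
    ext <;> norm_num
  -- The coefficient of `q` is `(26/8) · (3 · 2² · 24) - 504 = 432`.
  have hF : FirstOrder G 0 432 := by
    have h1 := eisTwo_firstOrder (p := 3) (by norm_num)
    have := (((h1.mul h1).mul h1).smul (26 / 8)).add (hE.add
      ((hE.comp_scale (p := 3) (by norm_num)).smul (-27)))
    rw [← hB, ← hA, ← hφ, ← hP] at this
    change FirstOrder ((26 / 8 : ℂ) • ⇑P + (⇑A + (-27 : ℂ) • ⇑B)) 0 432
    convert this using 1 <;> norm_num
  refine ⟨G.toCusp h3 hG, fun h => ?_⟩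
  have h0 : (G : ℍ → ℂ) = 0 := funext fun τ => DFunLike.congr_fun h τ
  rw [h0] at hF
  have := hF.unique (b' := 0) (by simp [FirstOrder])
  norm_num at this

/-- The series `E_k(τ)` and `E_k(pτ)` have values `(1, 1)` and `(1, p ^ (-k))`, which are
independent since `p ^ k ≠ 1`. -/
theorem cuspValues_surjective (hp : p.Prime) {k : ℕ} (hk : 3 ≤ k) (hk2 : Even k) :
    Function.Surjective (ModSpace.cuspValues p k) := by
  have hE := FirstOrder.of_levelOne (E hk)
  rw [EisensteinSeries.E_qExpansion_coeff_zero hk hk2] at hE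
  obtain ⟨A, -, vA⟩ := ModSpace.exists_levelOne (p := p) hp (E hk) hE.tendsto
  obtain ⟨B, -, vB⟩ := ModSpace.exists_comp_scale (p := p) hp (E hk) hE.tendsto
  set c : ℂ := (p : ℂ) ^ (-(k : ℤ)) * 1 with hc
  have hc1 : 1 - c ≠ 0 := by
    rw [hc, mul_one, sub_ne_zero]
    intro h
    have h1 : ((p ^ k : ℕ) : ℂ) = 1 := by
      rw [zpow_neg, zpow_natCast, eq_comm, inv_eq_one] at h
      exact_mod_cast h
    have h2 : p ^ k = 1 := by exact_mod_cast h1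
    exact hp.one_lt.ne' (Nat.pow_eq_one.mp h2 |>.resolve_right (by omega))
  rintro ⟨x, y⟩
  refine ⟨((y - x * c) / (1 - c)) • A + ((x - y) / (1 - c)) • B, ?_⟩
  rw [map_add, map_smul, map_smul, vA, vB]
  ext
  · simp only [Prod.fst_add, Prod.smul_fst, smul_eq_mul]
    field_simp
    ring
  · simp only [Prod.snd_add, Prod.smul_snd, smul_eq_mul]
    field_simp
    ring

end Forms

end Ghost
end

noncomputable section
namespace Ghost

/-! ### Dimension formulas -/

section DimensionFormulas

open UpperHalfPlane ModularForm ModularGroup Filter Module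
open CongruenceSubgroup (Gamma0 Gamma0_mem)
open scoped Manifold Topology

theorem finrank_cuspSpace_of_nonpos {p : ℕ} (hp : p.Prime) {k : ℤ} (hk : k ≤ 0) :
    finrank ℂ (CuspSpace p k) = 0 := by
  refine Nat.le_zero.mp (finrank_cuspSpace_le hp 0 ?_)
  nlinarith

theorem one_le_finrank_modSpace {p : ℕ} (hp : p.Prime) {k : ℤ} {F : ModSpace p k} (hF : F ≠ 0) :
    1 ≤ finrank ℂ (ModSpace p k) := by
  have := finiteDimensional_modSpace hp k
  have := nontrivial_of_ne F 0 hF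
  exact finrank_pos

theorem one_le_finrank_modSpace_zero {p : ℕ} (hp : p.Prime) :
    1 ≤ finrank ℂ (ModSpace p 0) := by
  refine one_le_finrank_modSpace hp (F := 1) fun h => ?_
  have := DFunLike.congr_fun h I
  simp at this

theorem one_le_finrank_modSpace_two {p : ℕ} [NeZero p] (hp : p.Prime) :
    1 ≤ finrank ℂ (ModSpace p 2) := by
  obtain ⟨F, -, hF⟩ := ModSpace.exists_eisTwo hp
  refine one_le_finrank_modSpace hp (F := F) fun h => ?_
  rw [h, map_zero] at hF
  have h1 : (p : ℂ) - 1 = 0 := (congrArg Prod.fst hF).symm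
  have h2 : (p : ℂ) = 1 := sub_eq_zero.mp h1
  exact hp.ne_one (by exact_mod_cast h2)

/-- Raising the weight by 4 gains two dimensions: modular forms embed into the cusp forms of the
next weight, and two Eisenstein directions come on top. -/
theorem le_finrank_modSpace_five (n : ℕ) :
    2 * n + 1 ≤ finrank ℂ (ModSpace 5 ((4 * n : ℕ) : ℤ)) := by
  have h5 : Nat.Prime 5 := by norm_num
  induction n with
  | zero => exact one_le_finrank_modSpace_zero h5
  | succ n ih =>
    obtain ⟨F, hF⟩ := exists_cuspForm_five
    have h1 := finrank_modSpace_le h5 (l := ((4 * n : ℕ) : ℤ)) (m := ((4 * (n + 1) : ℕ) : ℤ))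
      (by push_cast; ring) hF
    have h2 := finrank_modSpace_of_surjective h5 _
      (cuspValues_surjective h5 (k := 4 * (n + 1)) (by omega) (by simp [parity_simps]))
    omega

theorem finrank_cuspSpace_five (n : ℕ) :
    finrank ℂ (CuspSpace 5 ((4 * n : ℕ) : ℤ)) = 2 * n - 1 := by
  have h5 : Nat.Prime 5 := by norm_num
  rcases n with _ | n
  · exact finrank_cuspSpace_of_nonpos h5 (by simp)
  · refine le_antisymm (finrank_cuspSpace_le h5 _ ?_) ?_
    · push_cast
      omega
    · obtain ⟨F, hF⟩ := exists_cuspForm_five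
      have h1 := finrank_modSpace_le h5 (l := ((4 * n : ℕ) : ℤ)) (m := ((4 * (n + 1) : ℕ) : ℤ))
        (by push_cast; ring) hF
      have h2 := le_finrank_modSpace_five n
      omega

/-- As for `p = 5`, but in weight steps of 6. Weights 0 and 2 rest on the constants and on `eisTwo`,
weight 4 on the two Eisenstein directions alone. -/
theorem le_finrank_modSpace_three (n : ℕ) :
    2 * n / 3 + 1 ≤ finrank ℂ (ModSpace 3 ((2 * n : ℕ) : ℤ)) := by
  have h3 : Nat.Prime 3 := by norm_num
  induction n using Nat.strong_induction_on with
  | _ n ih =>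
    obtain rfl | rfl | hn : n = 0 ∨ n = 1 ∨ 2 ≤ n := by omega
    · exact one_le_finrank_modSpace_zero h3
    · exact one_le_finrank_modSpace_two h3
    · have h2 := finrank_modSpace_of_surjective h3 _
        (cuspValues_surjective h3 (k := 2 * n) (by omega) (by simp))
      obtain rfl | ⟨m, rfl⟩ : n = 2 ∨ ∃ m, n = m + 3 :=
        (Nat.eq_or_lt_of_le hn).imp Eq.symm fun h => ⟨n - 3, by omega⟩
      · omega
      · obtain ⟨F, hF⟩ := exists_cuspForm_three
        have h1 := finrank_modSpace_le h3 (l := ((2 * m : ℕ) : ℤ)) (m := ((2 * (m + 3) : ℕ) : ℤ))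
          (by push_cast; ring) hF
        have := ih m (by omega)
        omega

theorem finrank_cuspSpace_three (n : ℕ) :
    finrank ℂ (CuspSpace 3 ((2 * n : ℕ) : ℤ)) = 2 * n / 3 - 1 := by
  have h3 : Nat.Prime 3 := by norm_num
  refine le_antisymm (finrank_cuspSpace_le h3 _ ?_) ?_
  · push_cast
    omega
  · rcases lt_or_ge n 3 with hn | hn
    · interval_cases n <;> simp
    · obtain ⟨m, rfl⟩ := Nat.exists_eq_add_of_le' hn
      obtain ⟨F, hF⟩ := exists_cuspForm_three
      have h1 := finrank_modSpace_le h3 (l := ((2 * m : ℕ) : ℤ)) (m := ((2 * (m + 3) : ℕ) : ℤ))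
        (by push_cast; ring) hF
      have h2 := le_finrank_modSpace_three m
      omega

theorem levelGamma0_one : levelGamma0 1 = 𝒮ℒ := by
  have h : Gamma0 1 = ⊤ := eq_top_iff.mpr fun g _ => mem_Gamma0_iff_dvd.mpr (by simp)
  rw [levelGamma0, h, ← MonoidHom.range_eq_map]

theorem dimCusp_one (k : ℤ) : dimCusp 1 k = finrank ℂ (CuspForm 𝒮ℒ k) := by
  have key : ∀ (Γ : Subgroup (GL (Fin 2) ℝ)) [Γ.HasDetOne], Γ = 𝒮ℒ →
      finrank ℂ (CuspForm Γ k) = finrank ℂ (CuspForm 𝒮ℒ k) := by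
    rintro _ _ rfl
    rfl
  exact key _ levelGamma0_one

theorem dimCusp_one_of_even (K : ℕ) (hK : Even K) :
    dimCusp 1 K = if K % 12 = 2 then K / 12 - 1 else K / 12 := by
  rw [dimCusp_one]
  rcases lt_or_ge K 12 with h | h
  · rw [finrank_eq_of_rank_eq (n := 0)
      ((CuspForm.rank_eq_zero_of_weight_lt_twelve (by omega)).trans Nat.cast_zero.symm),
      Nat.div_eq_of_lt h]
    simp
  · have h1 := dimension_level_one K hK
    rw [rank_eq_one_add_rank_cuspForm (by omega) hK] at h1
    have h2 : Module.rank ℂ (CuspForm 𝒮ℒ K) < Cardinal.aleph0 := by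
      refine lt_of_le_of_lt (le_add_self) (h1.trans_lt ?_)
      exact Cardinal.natCast_lt_aleph0
    obtain ⟨m, hm⟩ := Cardinal.lt_aleph0.mp h2
    rw [finrank_eq_of_rank_eq hm]
    rw [hm] at h1
    have h3 : 1 + m = if K ≡ 2 [MOD 12] then K / 12 else K / 12 + 1 := by exact_mod_cast h1
    by_cases h4 : K % 12 = 2
    · rw [if_pos (show K ≡ 2 [MOD 12] from h4)] at h3
      rw [if_pos h4]
      omega
    · rw [if_neg (show ¬ K ≡ 2 [MOD 12] from h4)] at h3
      rw [if_neg h4]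
      omega

theorem dimCusp_one_two_mul (n : ℕ) : dimCusp 1 ((2 * n : ℕ) : ℤ) = cuspDimThree n := by
  rw [dimCusp_one_of_even _ (by simp), cuspDimThree]
  split_ifs <;> omega

theorem dimCusp_one_four_mul (n : ℕ) : dimCusp 1 ((4 * n : ℕ) : ℤ) = n / 3 := by
  rw [dimCusp_one_of_even _ (by simp [parity_simps])]
  split_ifs <;> omega

/-! ### The dimension of the old part of tame level one -/

variable {p : ℕ} [NeZero p]

theorem CuspSpace.slash_eq_of_levelOne {k : ℤ} (f : CuspSpace 1 k) (g : SL(2, ℤ)) :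
    (f : ℍ → ℂ) ∣[k] g = f :=
  f.slash_eq (mem_Gamma0_iff_dvd.mpr (by simp))

theorem CuspSpace.isZeroAtImInfty {k : ℤ} (f : CuspSpace 1 k) : IsZeroAtImInfty f := by
  simpa using f.isZeroAtImInfty_slash 1

variable (p) in
theorem isZeroAtImInfty_slash_S_comp_scale {k : ℤ} (f : CuspSpace 1 k) :
    IsZeroAtImInfty (((f : ℍ → ℂ) ∘ scale p) ∣[k] S) := by
  have := (Tendsto.comp f.isZeroAtImInfty (tendsto_divScale_atImInfty p)).const_mul
    ((p : ℂ) ^ (-k))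
  rw [mul_zero] at this
  refine this.congr fun τ => ?_
  rw [slash_S_comp_scale, CuspSpace.slash_eq_of_levelOne, Function.comp_apply]

/-- The map `(f, g) ↦ f(τ) + g(pτ)` onto the `p`-old forms of tame level one. -/
def oldMap (hp : (1 * p).Prime) (k : ℤ) :
    CuspSpace 1 k × CuspSpace 1 k →ₗ[ℂ] CuspSpace (1 * p) k where
  toFun x := CuspSpace.mk' hp (x.1 + x.2 ∘ scale p)
    ((CuspFormClass.holo x.1).add (mdiff_comp_scale p (CuspFormClass.holo x.2)))
    (fun g hg => by
      rw [one_mul] at hg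
      rw [SlashAction.add_slash, slash_comp_scale_of_slash_eq x.2.slash_eq_of_levelOne hg,
        CuspSpace.slash_eq_of_levelOne])
    (by
      have := Tendsto.add x.1.isZeroAtImInfty
        (Tendsto.comp x.2.isZeroAtImInfty (tendsto_scale_atImInfty p))
      rwa [add_zero] at this)
    (by
      have := Tendsto.add x.1.isZeroAtImInfty (isZeroAtImInfty_slash_S_comp_scale p x.2)
      rw [add_zero] at this
      rw [SlashAction.add_slash, CuspSpace.slash_eq_of_levelOne]
      exact this)
  map_add' x y := by
    ext τ
    exact add_add_add_comm (x.1 τ) (y.1 τ) (x.2 (scale p τ)) (y.2 (scale p τ))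
  map_smul' c x := by
    ext τ
    exact (mul_add c (x.1 τ) (x.2 (scale p τ))).symm

theorem oldMap_apply (hp : (1 * p).Prime) {k : ℤ} (x : CuspSpace 1 k × CuspSpace 1 k) (τ : ℍ) :
    oldMap hp k x τ = x.1 τ + x.2 (scale p τ) := rfl

theorem range_oldMap (hp : (1 * p).Prime) (k : ℤ) :
    LinearMap.range (oldMap hp k) = pOld 1 p k := by
  refine le_antisymm ?_ (Submodule.span_le.mpr ?_)
  · rintro _ ⟨x, rfl⟩
    rw [← Prod.fst_add_snd x, map_add]
    refine add_mem (Submodule.subset_span ⟨x.1, .inl fun τ => ?_⟩)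
      (Submodule.subset_span ⟨x.2, .inr fun τ => ?_⟩)
    · simp [oldMap_apply]
    · simp [oldMap_apply]
  · rintro h ⟨f, hf | hf⟩
    · refine ⟨(f, 0), CuspForm.ext fun τ => ?_⟩
      simp [oldMap_apply, hf]
    · refine ⟨(0, f), CuspForm.ext fun τ => ?_⟩
      simp [oldMap_apply, hf]

theorem tendsto_iterate_scale (hp : 2 ≤ p) (τ : ℍ) :
    Tendsto (fun n => (scale p)^[n] τ) atTop atImInfty := by
  rw [atImInfty, tendsto_comap_iff]
  have h (n : ℕ) : ((scale p)^[n] τ).im = (p : ℝ) ^ n * τ.im := by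
    induction n with
    | zero => simp
    | succ n ih => rw [Function.iterate_succ_apply', im_scale, ih, pow_succ']; ring
  have h1 : (1 : ℝ) < p := by exact_mod_cast hp
  exact ((tendsto_pow_atTop_atTop_of_one_lt h1).atTop_mul_const τ.im_pos).congr
    fun n => (h n).symm

/-- The hypothesis makes `|g|² y ^ k` invariant under `τ ↦ p²τ`, whose iterates go to `i∞`, where
this function tends to zero. -/
theorem CuspSpace.eq_zero_of_scale_scale (hp : 2 ≤ p) {k : ℤ} (g : CuspSpace 1 k)
    (h : ∀ τ, g (scale p (scale p τ)) = (p : ℂ) ^ (-k) * g τ) : g = 0 := by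
  have hp0 := natCast_ne_zero_of_neZero p
  have hinv (τ : ℍ) : petersson k g g (scale p (scale p τ)) = petersson k g g τ := by
    rw [petersson, petersson, h, im_scale, im_scale]
    push_cast
    rw [map_mul, map_zpow₀, Complex.conj_natCast, mul_zpow, mul_zpow, zpow_neg]
    have := zpow_ne_zero k hp0
    field_simp
  have hit (τ : ℍ) (n : ℕ) : petersson k g g ((scale p)^[2 * n] τ) = petersson k g g τ := by
    induction n with
    | zero => rfl
    | succ n ih =>
      rw [show 2 * (n + 1) = 2 * n + 1 + 1 by ring, Function.iterate_succ_apply',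
        Function.iterate_succ_apply', hinv, ih]
  have : Fact (IsCusp OnePoint.infty (levelGamma0 1)) :=
    ⟨(levelGamma0 1).isCusp_of_mem_strictPeriods one_pos (one_mem_strictPeriods_levelGamma0 1)⟩
  have hz := g.isZeroAtImInfty.petersson_isZeroAtImInfty_left k (levelGamma0 1) g
  refine CuspForm.ext fun τ => ?_
  have h2 : Tendsto (fun n : ℕ => 2 * n) atTop atTop :=
    tendsto_id.const_mul_atTop' (by norm_num)
  have h3 := (Tendsto.comp hz (tendsto_iterate_scale hp τ)).comp h2
  have h4 : petersson k g g τ = 0 :=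
    tendsto_nhds_unique (tendsto_const_nhds.congr fun n => (hit τ n).symm) h3
  rw [petersson, mul_eq_zero, mul_eq_zero, map_eq_zero, or_self] at h4
  exact h4.resolve_right (zpow_ne_zero _ (by exact_mod_cast τ.im_pos.ne'))

/-- Slashing `f(τ) + g(pτ) = 0` by `S` gives `f(τ) + p ^ (-k) g(τ/p) = 0`. Comparing the two at `pτ`
gives the relation that forces `g = 0`. -/
theorem oldMap_injective (hp : (1 * p).Prime) (k : ℤ) : Function.Injective (oldMap hp k) := by
  refine (injective_iff_map_eq_zero _).mpr fun x hx => ?_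
  have hp2 : 2 ≤ p := by simpa using hp.two_le
  have h1 : (x.1 : ℍ → ℂ) + x.2 ∘ scale p = 0 := funext fun τ => DFunLike.congr_fun hx τ
  have h2 : ((x.1 : ℍ → ℂ) + x.2 ∘ scale p) ∣[k] S = 0 := by rw [h1, SlashAction.zero_slash]
  rw [SlashAction.add_slash, CuspSpace.slash_eq_of_levelOne] at h2
  have hx2 : x.2 = 0 := by
    refine x.2.eq_zero_of_scale_scale hp2 fun τ => ?_
    have e1 := congrFun h1 (scale p τ)
    have e2 := congrFun h2 (scale p τ)
    have hd : divScale p (scale p τ) = τ := by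
      ext
      simp [mul_div_cancel_left₀ _ (natCast_ne_zero_of_neZero p)]
    rw [Pi.add_apply, slash_S_comp_scale, CuspSpace.slash_eq_of_levelOne, hd] at e2
    rw [Pi.add_apply, Function.comp_apply] at e1
    exact add_left_cancel (e1.trans e2.symm)
  refine Prod.ext (CuspForm.ext fun τ => ?_) hx2
  have e1 := congrFun h1 τ
  rw [Pi.add_apply, Function.comp_apply, hx2] at e1
  simpa using e1

theorem dimNew_one (hp : p.Prime) (k : ℤ) :
    dimNew 1 p k = finrank ℂ (CuspSpace p k) - 2 * dimCusp 1 k := by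
  have hp' : (1 * p).Prime := by rwa [one_mul]
  have := finiteDimensional_cuspSpace hp' k
  have : FiniteDimensional ℂ (CuspSpace 1 k × CuspSpace 1 k) :=
    FiniteDimensional.of_injective _ (oldMap_injective hp' k)
  have : FiniteDimensional ℂ (CuspSpace 1 k) :=
    Module.Finite.of_surjective (LinearMap.fst ℂ (CuspSpace 1 k) (CuspSpace 1 k))
      LinearMap.fst_surjective
  have h1 := finrank_pOld_add_finrank_pNew 1 p k
  have h2 := LinearMap.finrank_range_of_inj (oldMap_injective hp' k)
  rw [range_oldMap, finrank_prod] at h2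
  have h3 : finrank ℂ (CuspSpace (1 * p) k) = finrank ℂ (CuspSpace p k) := by rw [one_mul]
  rw [dimNew, dimCusp]
  omega

theorem hill_eq_zero_of_nonpos {l i : ℤ} (hl : l ≤ 0) : hill l i = 0 := by
  rw [hill, if_neg (by omega), if_neg (by omega)]

theorem mult_of_nonpos (hp : p.Prime) {k : ℤ} (hk : k ≤ 0) (i : ℕ) : mult 1 p k i = 0 := by
  rw [mult, hill_eq_zero_of_nonpos]
  rw [dimNew_one hp, finrank_cuspSpace_of_nonpos hp hk]
  omega

theorem mult_three (n i : ℕ) : mult 1 3 ((2 * n : ℕ) : ℤ) i =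
    hill (((2 * n / 3 - 1 - 2 * cuspDimThree n : ℕ) : ℤ) - 1) ((i : ℤ) - cuspDimThree n) := by
  rw [mult, dimNew_one (by norm_num), finrank_cuspSpace_three, dimCusp_one_two_mul]

theorem mult_five (n i : ℕ) : mult 1 5 ((4 * n : ℕ) : ℤ) i =
    hill (((2 * n - 1 - 2 * (n / 3) : ℕ) : ℤ) - 1) ((i : ℤ) - ((n / 3 : ℕ) : ℤ)) := by
  rw [mult, dimNew_one (by norm_num), finrank_cuspSpace_five, dimCusp_one_four_mul]

end DimensionFormulas

end Ghost
end

noncomputable section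
namespace Ghost

/-! ### The ghost series at the weight `0` -/

section GhostAtZero

open Polynomial
open scoped Nat

theorem hill_of_arg_nonpos {l i : ℤ} (hi : i ≤ 0) : hill l i = 0 := by
  rw [hill, if_neg (by omega), if_neg (by omega)]

theorem mult_eq_zero_of_le {p : ℕ} [NeZero p] {k : ℤ} {i : ℕ} (h : i ≤ dimCusp 1 k) :
    mult 1 p k i = 0 :=
  hill_of_arg_nonpos (by omega)

variable {p : ℕ} [Fact p.Prime]

instance : NeZero p := ⟨(Fact.out : p.Prime).ne_zero⟩

theorem coord_ofInt_zero (γ : ℤ_[p]ˣ) : (EvenWeight.ofInt p 0 Even.zero).coord γ = 0 := by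
  have h : (EvenWeight.ofInt p 0 Even.zero).char γ = 1 := zpow_zero _
  rw [EvenWeight.coord, h, Units.val_one, sub_self]

theorem coeff_ghostAt_zero (γ : ℤ_[p]ˣ) (i : ℕ) :
    (ghostAt 1 γ (EvenWeight.ofInt p 0 Even.zero)).coeff i =
      (ghostCoeff 1 γ (EvenWeight.ofInt p 0 Even.zero).tame i).eval₂ (toCp p) 0 := by
  rw [ghostAt, PowerSeries.coeff_map, ghostSeries, PowerSeries.coeff_mk, coord_ofInt_zero,
    coe_eval₂RingHom]
  rcases eq_or_ne i 0 with rfl | hi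
  · rw [if_pos rfl, ghostCoeff]
    simp [mult_eq_zero_of_le]
  · rw [if_neg hi]

/-- Negative multiples of `c` drop out for lack of cusp forms, and large ones by `hN`. -/
theorem ghostCoeff_eq_prod (γ : ℤ_[p]ˣ) {ε : CommGroup.torsion ℤ_[p]ˣ →* ℂ_[p]ˣ} {c : ℕ}
    (hc : c ≠ 0) (hε : intWeights ε = {k : ℤ | (c : ℤ) ∣ k}) {i N : ℕ}
    (hN : ∀ n, N ≤ n → mult 1 p ((c * n : ℕ) : ℤ) i = 0) :
    ghostCoeff 1 γ ε i = ∏ n ∈ Finset.range N,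
      (X - C (intCoord γ ((c * n : ℕ) : ℤ))) ^ mult 1 p ((c * n : ℕ) : ℤ) i := by
  have hp : p.Prime := Fact.out
  have hinj : Function.Injective fun n : ℕ => ((c * n : ℕ) : ℤ) := fun a b h =>
    Nat.eq_of_mul_eq_mul_left (Nat.pos_of_ne_zero hc) (Int.ofNat_injective h)
  rw [ghostCoeff, hε, ← Finset.prod_image (s := Finset.range N)
    (f := fun k : ℤ => (X - C (intCoord γ k)) ^ mult 1 p k i) hinj.injOn]
  refine finprod_mem_eq_prod_of_inter_mulSupport_eq _ ?_
  ext k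
  simp only [Set.mem_inter_iff, Set.mem_ofPred_eq, Finset.coe_image, Set.mem_image,
    Finset.coe_range, Set.mem_Iio, Function.mem_mulSupport]
  refine and_congr_left fun hk => ⟨?_, ?_⟩
  · rintro ⟨m, rfl⟩
    have hm : mult 1 p (c * m) i ≠ 0 := fun h => hk (by rw [h, pow_zero])
    have h0 : 0 ≤ m := by
      by_contra h
      exact hm (mult_of_nonpos hp (mul_nonpos_of_nonneg_of_nonpos (by positivity) (by omega)) i)
    lift m to ℕ using h0
    refine ⟨m, ?_, by push_cast; rfl⟩
    by_contra h
    exact hm (by simpa using hN m (not_lt.mp h))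
  · rintro ⟨n, -, rfl⟩
    exact ⟨n, by push_cast; rfl⟩

theorem val_coeff_ghostAt_zero (hodd : Odd p) {γ : ℤ_[p]ˣ} (hγ : IsTopGenerator p γ) {c : ℕ}
    (hc : ¬ p ∣ c) (hε : intWeights (EvenWeight.ofInt p 0 Even.zero).tame = {k : ℤ | (c : ℤ) ∣ k})
    {i N : ℕ} (hN : ∀ n, N ≤ n → mult 1 p ((c * n : ℕ) : ℤ) i = 0) :
    (ghostAt 1 γ (EvenWeight.ofInt p 0 Even.zero)).coeff i ≠ 0 ∧
      val ((ghostAt 1 γ (EvenWeight.ofInt p 0 Even.zero)).coeff i) =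
        ((∑ n ∈ Finset.range N, (mult 1 p ((c * n : ℕ) : ℤ) i : ℤ) * (1 + padicValNat p n) : ℤ) :
          ℝ) := by
  have hp : p.Prime := Fact.out
  have hc0 : c ≠ 0 := by
    rintro rfl
    exact hc (dvd_zero p)
  rw [coeff_ghostAt_zero, ghostCoeff_eq_prod γ hc0 hε hN, eval₂_finsetProd]
  simp only [eval₂_pow, eval₂_sub, eval₂_X, eval₂_C, zero_sub]
  have hne (n : ℕ) : (-toCp p (intCoord γ ((c * n : ℕ) : ℤ))) ^ mult 1 p ((c * n : ℕ) : ℤ) i ≠ 0 := by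
    -- The weight `k = 0` is the only one whose factor vanishes at `w = 0`, and its exponent is
    -- zero.
    rcases eq_or_ne n 0 with rfl | hn
    · rw [mult_of_nonpos hp (by simp), pow_zero]
      exact one_ne_zero
    · exact pow_ne_zero _ (neg_ne_zero.mpr (val_intCoord hodd hγ (mul_ne_zero hc0 hn)).1)
  refine ⟨Finset.prod_ne_zero_iff.mpr fun n _ => hne n, ?_⟩
  rw [val, norm_prod, Real.logb_prod _ _ fun n _ => norm_ne_zero_iff.mpr (hne n),
    ← Finset.sum_neg_distrib, Int.cast_sum]
  refine Finset.sum_congr rfl fun n _ => ?_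
  rcases eq_or_ne n 0 with rfl | hn
  · simp [mult_of_nonpos hp]
  · have h := (val_intCoord hodd hγ (mul_ne_zero hc0 hn)).2
    rw [padicValNat.mul hc0 hn, padicValNat.eq_zero_of_not_dvd hc, zero_add, val] at h
    rw [norm_pow, norm_neg, Real.logb_pow, ← mul_neg, h]
    simp only [Int.cast_add, Int.cast_mul, Int.cast_natCast, Int.cast_one]

/-- Gives the convexity of the polygon: `(cm)!/m!` has nondecreasing valuation in `m`, because
`(c(m+1))!` is `c(m+1)` times a multiple of `(cm)!`. -/
theorem padicValNat_factorial_mul_add_le (c m : ℕ) (hc : c ≠ 0) :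
    padicValNat p (c * m)! + padicValNat p (m + 1)! ≤
      padicValNat p (c * (m + 1))! + padicValNat p m ! := by
  have hdvd : (c * m)! * (m + 1) ∣ (c * (m + 1))! := by
    have h0 : c * (m + 1) ≠ 0 := mul_ne_zero hc m.succ_ne_zero
    have h1 : (c * m)! ∣ (c * (m + 1) - 1)! :=
      Nat.factorial_dvd_factorial (by rw [mul_add]; omega)
    rw [← Nat.mul_factorial_pred h0, mul_comm]
    exact mul_dvd_mul (dvd_mul_left _ _) h1
  obtain ⟨Y, hY⟩ := hdvd
  have hY0 : Y ≠ 0 := by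
    rintro rfl
    exact Nat.factorial_ne_zero _ hY
  rw [hY, padicValNat.mul (mul_ne_zero (Nat.factorial_ne_zero _) m.succ_ne_zero) hY0,
    padicValNat.mul (Nat.factorial_ne_zero _) m.succ_ne_zero, Nat.factorial_succ,
    padicValNat.mul m.succ_ne_zero (Nat.factorial_ne_zero _)]
  omega

end GhostAtZero

/-! ### The slopes for `p = 3` and `p = 5`. -/

theorem newtonSlope_ghostAt_three [Fact (Nat.Prime 3)] {γ : ℤ_[3]ˣ} (hγ : IsTopGenerator 3 γ)
    (j : ℕ) : newtonSlope (ghostAt 1 γ (EvenWeight.ofInt 3 0 Even.zero)) (j + 1) =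
      ((2 * ((j + 1 : ℕ) : ℝ) + 2 *
        (padicValRat 3 (((2 * (j + 1)).factorial : ℚ) / ((j + 1).factorial : ℚ)) : ℝ) : ℝ) :
        EReal) := by
  set P := ghostAt 1 γ (EvenWeight.ofInt 3 0 Even.zero)
  -- From `n = 6i + 2` on, `dim S_{2n} ≥ i`, so the multiplicity vanishes; at `n = 6i + 1` the
  -- dimension is still smaller when `i ≥ 1`.
  have hval (i N : ℕ) (hN : 6 * i + 2 ≤ N) : P.coeff i ≠ 0 ∧ val (P.coeff i) =
      ((∑ n ∈ Finset.range N, (mult 1 3 ((2 * n : ℕ) : ℤ) i : ℤ) * (1 + padicValNat 3 n) : ℤ) :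
        ℝ) := by
    refine val_coeff_ghostAt_zero (by decide) hγ (by norm_num) intWeights_three fun n hn => ?_
    refine mult_eq_zero_of_le ?_
    rw [dimCusp_one_two_mul, cuspDimThree]
    split_ifs <;> omega
  have hdiff (i : ℕ) : val (P.coeff (i + 1)) - val (P.coeff i) =
      2 * (i + 1) + 2 * ((padicValNat 3 (2 * (i + 1)).factorial : ℝ) -
        padicValNat 3 (i + 1).factorial) := by
    rw [(hval (i + 1) (6 * i + 8) (by omega)).2, (hval i (6 * i + 8) (by omega)).2]
    simp only [mult_three]
    rw [sum_hill_three i _ le_rfl]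
    simp only [Int.cast_add, Int.cast_mul, Int.cast_sub, Int.cast_natCast, Int.cast_ofNat, Int.cast_one]
    ring
  rw [newtonSlope_eq (y := fun i => val (P.coeff i)) (fun i => (hval i _ le_rfl).1)
    (fun i => rfl) ?_ j, hdiff, padicValRat_factorial_div]
  · simp only [Int.cast_sub, Int.cast_natCast, Nat.cast_add, Nat.cast_one]
  · refine monotone_nat_of_le_succ fun i => ?_
    rw [hdiff, hdiff]
    have h := padicValNat_factorial_mul_add_le (p := 3) 2 (i + 1) (by norm_num)
    have h' : ((padicValNat 3 (2 * (i + 1)).factorial : ℝ) + padicValNat 3 (i + 1 + 1).factorial ≤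
      padicValNat 3 (2 * (i + 1 + 1)).factorial + padicValNat 3 (i + 1).factorial) := by
      exact_mod_cast h
    push_cast
    linarith

theorem newtonSlope_ghostAt_five [Fact (Nat.Prime 5)] {γ : ℤ_[5]ˣ} (hγ : IsTopGenerator 5 γ)
    (j : ℕ) : newtonSlope (ghostAt 1 γ (EvenWeight.ofInt 5 0 Even.zero)) (j + 1) =
      ((((j + 1 : ℕ) : ℝ) + 2 *
        (padicValRat 5 (((3 * (j + 1)).factorial : ℚ) / ((j + 1).factorial : ℚ)) : ℝ) : ℝ) :
        EReal) := by
  set P := ghostAt 1 γ (EvenWeight.ofInt 5 0 Even.zero)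
  have hval (i N : ℕ) (hN : 3 * i ≤ N) : P.coeff i ≠ 0 ∧ val (P.coeff i) =
      ((∑ n ∈ Finset.range N, (mult 1 5 ((4 * n : ℕ) : ℤ) i : ℤ) * (1 + padicValNat 5 n) : ℤ) :
        ℝ) := by
    refine val_coeff_ghostAt_zero (by decide) hγ (by norm_num) intWeights_five fun n hn => ?_
    refine mult_eq_zero_of_le ?_
    rw [dimCusp_one_four_mul]
    omega
  have hdiff (i : ℕ) : val (P.coeff (i + 1)) - val (P.coeff i) =
      (i + 1) + 2 * ((padicValNat 5 (3 * (i + 1)).factorial : ℝ) -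
        padicValNat 5 (i + 1).factorial) := by
    rw [(hval (i + 1) (3 * i + 3) (by omega)).2, (hval i (3 * i + 3) (by omega)).2]
    simp only [mult_five]
    rw [sum_hill_five i _ le_rfl]
    simp only [Int.cast_add, Int.cast_mul, Int.cast_sub, Int.cast_natCast, Int.cast_ofNat, Int.cast_one]
    ring
  rw [newtonSlope_eq (y := fun i => val (P.coeff i)) (fun i => (hval i _ le_rfl).1)
    (fun i => rfl) ?_ j, hdiff, padicValRat_factorial_div]
  · simp only [Int.cast_sub, Int.cast_natCast, Nat.cast_add, Nat.cast_one]
  · refine monotone_nat_of_le_succ fun i => ?_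
    rw [hdiff, hdiff]
    have h := padicValNat_factorial_mul_add_le (p := 5) 3 (i + 1) (by norm_num)
    have h' : ((padicValNat 5 (3 * (i + 1)).factorial : ℝ) + padicValNat 5 (i + 1 + 1).factorial ≤
      padicValNat 5 (3 * (i + 1 + 1)).factorial + padicValNat 5 (i + 1).factorial) := by
      exact_mod_cast h
    push_cast
    linarith

end Ghost
end

theorem proposition3p6 (p : ℕ) [Fact p.Prime] (γ : ℤ_[p]ˣ) (hγ : Ghost.IsTopGenerator p γ) :
    (p = 3 → ∀ i : ℕ, 1 ≤ i →
      Ghost.newtonSlope (Ghost.ghostAt 1 γ (Ghost.EvenWeight.ofInt p 0 Even.zero)) i =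
        ((2 * (i : ℝ) + 2 *
          (padicValRat 3 (((2 * i).factorial : ℚ) / (i.factorial : ℚ)) : ℝ) : ℝ) : EReal)) ∧
    (p = 5 → ∀ i : ℕ, 1 ≤ i →
      Ghost.newtonSlope (Ghost.ghostAt 1 γ (Ghost.EvenWeight.ofInt p 0 Even.zero)) i =
        (((i : ℝ) + 2 *
          (padicValRat 5 (((3 * i).factorial : ℚ) / (i.factorial : ℚ)) : ℝ) : ℝ) : EReal)) := by
  refine ⟨?_, ?_⟩
  · rintro rfl i hi
    obtain ⟨j, rfl⟩ := Nat.exists_eq_add_of_le' hi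
    exact Ghost.newtonSlope_ghostAt_three hγ j
  · rintro rfl i hi
    obtain ⟨j, rfl⟩ := Nat.exists_eq_add_of_le' hi
    exact Ghost.newtonSlope_ghostAt_five hγ j
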